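/- Let $1\le k\le n$ be integers, let $\theta\in(0,\pi)$, and let $e=-e_{n+1}=(0,\dots,0,-1)\in\mathbb{R}^{n+1}$, the outward unit normal of the half-space $\overline{\mathbb{R}}^{n+1}_+=\{y\in\mathbb{R}^{n+1} : y_{n+1}\ge 0\}$ along its boundary $\{y_{n+1}=0\}$. Let $M$ be a compact smooth $n$-dimensional manifold with boundary, let $x:M\to\overline{\mathbb{R}}^{n+1}_+$ be a smooth immersion with $x(\partial M)\subset\{y_{n+1}=0\}$, and let $\nu:M\to\mathbb{R}^{n+1}$ be a smooth unit normal field along $x$. Suppose that $\Sigma=x(M)$ is capillary with constant contact angle $\theta$, that is, $\langle\nu,e\rangle=\cos(\pi-\theta)$ along $\partial M$. Let $g$ be the metric on $M$ induced by $x$, let $dA$ be its area measure, and let $h(X,Y)=-\langle D_X(dx(Y)),\nu\rangle=\langle D_X\nu,dx(Y)\rangle$ be the second fundamental form. Let $\kappa_1,\dots,\kappa_n$ be the eigenvalues of $h$ with respect to $g$, and let $H_j=\binom{n}{j}^{-1}\sigma_j(\kappa_1,\dots,\kappa_n)$ be the normalized $j$-th mean curvature, where $\sigma_j$ is the $j$-th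 elementary symmetric polynomial and $H_0=1$. Then both integrands below are integrable and $$\int_\Sigma H_{k-1}\,\bigl(1+\cos\theta\,\langle\nu,e\rangle\bigr)\,dA=\int_\Sigma H_k\,\langle x,\nu\rangle\,dA ,$$ where the integrals over $\Sigma$ are taken over $M$ with respect to $dA$. -/

import Mathlib

open MeasureTheory
open scoped Manifold ContDiff Matrix

noncomputable section

namespace CapillaryHalfSpace

/-- The vector `e = -e_{n+1}` of `ℝ^{n+1}`, which is also the outward unit normal of the upper
half-space `{y | 0 ≤ y_{n+1}}` along its boundary hyperplane `{y | y_{n+1} = 0}`. -/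
def e (n : ℕ) : EuclideanSpace ℝ (Fin (n + 1)) :=
  -EuclideanSpace.single (Fin.last n) 1

section Hypersurface

variable {n : ℕ} [NeZero n] {M : Type*} [TopologicalSpace M]
  [ChartedSpace (EuclideanHalfSpace n) M]

/-- The differential `df_p` of a map `f : M → ℝ^{n+1}`, where the tangent space of the `n`-manifold
with boundary `M` at `p` is identified with `ℝⁿ` through the preferred chart at `p`. -/
def differential (f : M → EuclideanSpace ℝ (Fin (n + 1))) (p : M) :
    EuclideanSpace ℝ (Fin n) →L[ℝ] EuclideanSpace ℝ (Fin (n + 1)) :=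
  mfderiv (𝓡∂ n) 𝓘(ℝ, EuclideanSpace ℝ (Fin (n + 1))) f p

/-- `x : M → ℝ^{n+1}` is a smooth immersion into the closed upper half-space that maps `∂M` into
the boundary hyperplane, `ν` is a smooth unit normal field along `x`, and the contact angle,
defined by `⟨ν, N⟩ = cos (π - θ)` with `N = e` the outward unit normal of the half-space, is equal
to the constant `θ` along `∂M`. -/
structure IsCapillaryImmersion (θ : ℝ) (x ν : M → EuclideanSpace ℝ (Fin (n + 1))) : Prop where
  smooth : ContMDiff (𝓡∂ n) 𝓘(ℝ, EuclideanSpace ℝ (Fin (n + 1))) ∞ x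
  immersion : ∀ p, Function.Injective (differential x p)
  mem_halfSpace : ∀ p, 0 ≤ x p (Fin.last n)
  boundary_mem : ∀ p ∈ (𝓡∂ n).boundary M, x p (Fin.last n) = 0
  smooth_normal : ContMDiff (𝓡∂ n) 𝓘(ℝ, EuclideanSpace ℝ (Fin (n + 1))) ∞ ν
  norm_normal : ∀ p, ‖ν p‖ = 1
  normal_orthogonal : ∀ p v, inner ℝ (ν p) (differential x p v) = 0
  contact_angle : ∀ p ∈ (𝓡∂ n).boundary M, inner ℝ (ν p) (e n) = Real.cos (Real.pi - θ)

/-- The matrix `g_{ij} = ⟨dx(∂_i), dx(∂_j)⟩` at `p` of the induced metric. -/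
def metric (x : M → EuclideanSpace ℝ (Fin (n + 1))) (p : M) : Matrix (Fin n) (Fin n) ℝ :=
  Matrix.of fun i j =>
    inner ℝ (differential x p (EuclideanSpace.single i 1))
      (differential x p (EuclideanSpace.single j 1))

/-- The matrix `h_{ij}` at `p` of the second fundamental form `h(X, Y) = -⟨D_X (dx Y), ν⟩`, that is
`D_X Y = ∇_X Y - h(X, Y) ν`. As `⟨dx Y, ν⟩ = 0`, this is `h(X, Y) = ⟨D_X ν, dx Y⟩`. -/
def secondFundamentalForm (x ν : M → EuclideanSpace ℝ (Fin (n + 1))) (p : M) :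
    Matrix (Fin n) (Fin n) ℝ :=
  Matrix.of fun i j =>
    inner ℝ (differential ν p (EuclideanSpace.single i 1))
      (differential x p (EuclideanSpace.single j 1))

/-- The principal curvatures at `p`: the eigenvalues, with multiplicity, of the Weingarten map
`h^i_j = g^{ik} h_{kj}`. -/
def principalCurvatures (x ν : M → EuclideanSpace ℝ (Fin (n + 1))) (p : M) : Multiset ℝ :=
  ((metric x p)⁻¹ * secondFundamentalForm x ν p).charpoly.roots

/-- The normalized `k`-th mean curvature `H_k = σ_k(κ) / (n choose k)`; in particular `H_0 = 1`. -/
def meanCurvature (x ν : M → EuclideanSpace ℝ (Fin (n + 1))) (k : ℕ) (p : M) : ℝ :=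
  (principalCurvatures x ν p).esymm k / (n.choose k : ℝ)

/-- The Gram matrix, at the point `y` of the image of the preferred chart `φ` at `p`, of the
coordinate derivatives of `x ∘ φ⁻¹`: the metric in the coordinates `φ`. -/
def chartMetric (x : M → EuclideanSpace ℝ (Fin (n + 1))) (p : M) (y : EuclideanSpace ℝ (Fin n)) :
    Matrix (Fin n) (Fin n) ℝ :=
  Matrix.of fun i j =>
    inner ℝ
      (fderivWithin ℝ (x ∘ (extChartAt (𝓡∂ n) p).symm) (Set.range (𝓡∂ n)) y
        (EuclideanSpace.single i 1))
      (fderivWithin ℝ (x ∘ (extChartAt (𝓡∂ n) p).symm) (Set.range (𝓡∂ n)) y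
        (EuclideanSpace.single j 1))

/-- The area measure of the induced metric on the domain of the preferred chart `φ` at `p` (and
zero outside of it): `A ↦ ∫_{φ(A)} √(det g_{ij}(y)) dy`. -/
def chartArea [MeasurableSpace M] (x : M → EuclideanSpace ℝ (Fin (n + 1))) (p : M) : Measure M :=
  Measure.map (extChartAt (𝓡∂ n) p).symm
    ((volume.restrict (extChartAt (𝓡∂ n) p).target).withDensity
      fun y => ENNReal.ofReal (Real.sqrt (chartMetric x p y).det))

/-- The area measure `dA` of the metric induced by `x`. The measures on the chart domains agree on
overlaps, so that their supremum in the lattice of measures is the measure on `M` that restricts to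
each of them. -/
def areaMeasure [MeasurableSpace M] (x : M → EuclideanSpace ℝ (Fin (n + 1))) : Measure M :=
  ⨆ p : M, chartArea x p

end Hypersurface

end CapillaryHalfSpace

end

/-! All `k` are treated at once by a generating variable `t`, through the parallel maps `x + tν`.
Put `c = cos θ`, `a_j = ∂_j x + t ∂_j ν`, and `Y = x + c (⟨ν, e⟩ x - ⟨x, ν⟩ e)`. In a chart consider
the field with components `W^i = vol (ν; a_1, …, Y, …, a_n)`, with `Y` in slot `i`. By Cramer's rule
`W^i = vol (ν; ∂x) V^i` with `V = adj (1 + tA) Yᵀ`, where `A` is the shape operator and `Yᵀ` the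
tangential part of `Y`. As `adj (1 + tA)` generates the Newton transformations, this is the usual
divergence argument for Minkowski formulas, carried out with determinants instead of covariant
derivatives.

Divergence: since `∂_i a_j = ∂_j a_i`, the terms that differentiate the `a_j` cancel in pairs
(`hasFDerivAt_vol₁_update`). What remains is pointwise algebra (`IsFrame.sum_vol₁_capillaryField`).
Differentiating `ν` gives `-⟨x, ν⟩` times the `t`-derivative of `vol (ν; a) = vol (ν; ∂x) det (1 +
tA)`. Differentiating `Y` gives the terms in `1 + c ⟨ν, e⟩`, while the terms containing `⟨∂_i ν, e⟩
x - ⟨x, ∂_i ν⟩ e` cancel because `h · adj (1 + tA)` is symmetric. The coefficient of `t^j` is `(n -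
j) σ_j (1 + c ⟨ν, e⟩) - (j + 1) σ_{j+1} ⟨x, ν⟩`, up to the Jacobian.

Boundary: there `⟨x, e⟩ = 0` and `⟨ν, e⟩ = -c`, so all arguments of `vol` in the normal component of
`W` are orthogonal to the nonzero vector `e + cν`, and the flux vanishes
(`IsLocalSurface.flux_boundary`).

Globally, the divergence theorem on the half-space is applied to `φ_i W` for a finite partition of
unity `φ_i` subordinate to charts. The terms `dφ_i(V)` add up to zero because `V` does not depend on
the frame. The resulting integral vanishes for every `t`; comparing coefficients and using `k C(n,
k) = (n - k + 1) C(n, k - 1)` gives the formula. -/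

noncomputable section

/-! ### Linear algebra: adjugates, real spectrum of `G⁻¹ h`, symmetric functions of eigenvalues. -/

namespace Matrix

variable {ι R : Type*} [Fintype ι] [DecidableEq ι] [CommRing R]

/-- If `det Q` is regular, it can be cancelled from `det Q • (A adj Q) = adj Q (QA) adj Q = adj Q
(AQ) adj Q = det Q • (adj Q A)`. The general case follows by replacing `Q` with `X + Q` over `R[X]`,
whose determinant is monic, and then evaluating at `X = 0`. -/
theorem commute_adjugate_of_commute {A Q : Matrix ι ι R} (h : Commute A Q) :
    Commute A Q.adjugate := by
  set P : Matrix ι ι (Polynomial R) := charmatrix (-Q) with hP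
  set A' : Matrix ι ι (Polynomial R) := A.map Polynomial.C with hA'
  have hPA : A' * P = P * A' := by
    have hQ : A' * Q.map Polynomial.C = Q.map Polynomial.C * A' := by
      rw [hA', ← Matrix.map_mul, ← Matrix.map_mul, h.eq]
    have h1 : P = scalar ι Polynomial.X + Q.map Polynomial.C := by
      rw [hP, charmatrix]
      simp [sub_eq_add_neg]
      ext; simp
    rw [h1, mul_add, add_mul, hQ]
    congr 1
    exact ((scalar_commute _ (fun r => Commute.all _ _) _).eq).symm
  have hdet : P.det.Monic := charpoly_monic (-Q)
  have h2 : P.det • (A' * P.adjugate) = P.det • (P.adjugate * A') := by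
    calc P.det • (A' * P.adjugate) = P.adjugate * P * (A' * P.adjugate) := by
            rw [adjugate_mul]; simp
      _ = P.adjugate * (A' * P) * P.adjugate := by rw [hPA]; simp only [Matrix.mul_assoc]
      _ = P.adjugate * A' * (P * P.adjugate) := by simp only [Matrix.mul_assoc]
      _ = _ := by rw [mul_adjugate]; simp
  have h3 : A' * P.adjugate = P.adjugate * A' := by
    ext1 i j
    have := congrFun (congrFun h2 i) j
    simp only [smul_apply, smul_eq_mul] at this
    exact hdet.isRegular.left this
  have h4 := congrArg (fun M : Matrix ι ι (Polynomial R) => M.map (Polynomial.evalRingHom 0)) h3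
  have h5 : P.map (Polynomial.evalRingHom 0) = Q := by
    ext i j
    by_cases hij : i = j
    · subst hij; simp [hP, charmatrix]
    · simp [hP, charmatrix, hij]
  have h6 : A'.map (Polynomial.evalRingHom 0) = A := by
    ext i j; simp [hA']
  have h7 : P.adjugate.map (Polynomial.evalRingHom 0) = Q.adjugate := by
    have := RingHom.map_adjugate (Polynomial.evalRingHom (0 : R)) P
    simp only [RingHom.mapMatrix_apply] at this
    rw [this, h5]
  simp only [Matrix.map_mul, h6, h7] at h4
  exact h4

/-- With `C = G⁻¹ h` and `Q = 1 + tC`, symmetry of `G` and `h` says `Qᵀ G = G Q`. The adjugates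
inherit this relation, and `adj Q` commutes with `C`; transposing `h adj Q = G C adj Q` then returns
the same matrix. -/
theorem isSymm_mul_adjugate_one_add {G h : Matrix ι ι ℝ} (hG : G.IsSymm) (hGu : IsUnit G.det)
    (hh : h.IsSymm) (t : ℝ) : (h * (1 + t • (G⁻¹ * h)).adjugate).IsSymm := by
  set C := G⁻¹ * h with hC
  set Q := 1 + t • C with hQ
  have hGC : G * C = h := by rw [hC, ← Matrix.mul_assoc, Matrix.mul_nonsing_inv _ hGu, one_mul]
  have hQT : Qᵀ * G = G * Q := by
    have : Cᵀ * G = h := by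
      have := congrArg transpose hGC
      rwa [transpose_mul, hG.eq, hh.eq] at this
    rw [hQ, transpose_add, transpose_smul, transpose_one, add_mul, mul_add, smul_mul,
      Matrix.mul_smul, this, hGC, one_mul, mul_one]
  have h1 : Qᵀ.adjugate * G = G * Q.adjugate := by
    have h2 := congrArg adjugate hQT
    rw [adjugate_mul_distrib, adjugate_mul_distrib] at h2
    have h3 : G * (G.adjugate * Qᵀ.adjugate) * G = G * (Q.adjugate * G.adjugate) * G := by rw [h2]
    rw [← Matrix.mul_assoc, mul_adjugate, Matrix.mul_assoc, Matrix.mul_assoc, Matrix.mul_assoc,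
      adjugate_mul] at h3
    simp only [Matrix.smul_mul, Matrix.mul_smul, one_mul, mul_one] at h3
    exact smul_right_injective _ hGu.ne_zero h3
  have hcomm : Commute C Q.adjugate := by
    refine commute_adjugate_of_commute ?_
    rw [hQ]
    exact (Commute.one_right _).add_right ((Commute.refl C).smul_right t)
  rw [IsSymm, transpose_mul, hh.eq, adjugate_transpose]
  calc Qᵀ.adjugate * h = Qᵀ.adjugate * G * C := by rw [Matrix.mul_assoc, hGC]
    _ = G * (Q.adjugate * C) := by rw [h1, Matrix.mul_assoc]
    _ = h * Q.adjugate := by rw [← hcomm.eq, ← Matrix.mul_assoc, hGC]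

open scoped ComplexOrder MatrixOrder Matrix.Norms.L2Operator in
-- Writing `G = Bᵀ B` makes `G⁻¹ h` similar to the symmetric matrix `B⁻ᵀ h B⁻¹`. Hence the multiset
-- of real roots contains all the eigenvalues, and its `esymm` are the genuine symmetric functions.
theorem splits_charpoly_inv_mul {G h : Matrix ι ι ℝ} (hG : G.PosDef) (hh : h.IsSymm) :
    (G⁻¹ * h).charpoly.Splits := by
  obtain ⟨B, hB⟩ := CStarAlgebra.nonneg_iff_eq_star_mul_self.mp
    (Matrix.nonneg_iff_posSemidef.mpr hG.posSemidef)
  have hB' : G = Bᵀ * B := by simpa [star_eq_conjTranspose] using hB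
  have hGu : IsUnit G.det := (isUnit_iff_isUnit_det _).1 hG.isUnit
  have hBu : IsUnit B.det := by
    rw [hB', det_mul] at hGu
    exact isUnit_of_mul_isUnit_right hGu
  have hBtu : IsUnit Bᵀ.det := by rwa [det_transpose]
  have hS : ((Bᵀ)⁻¹ * h * B⁻¹).IsHermitian := by
    rw [IsHermitian, conjTranspose_eq_transpose_of_trivial, transpose_mul, transpose_mul, hh.eq,
      transpose_nonsing_inv, transpose_nonsing_inv, transpose_transpose, Matrix.mul_assoc]
  have key : (G⁻¹ * h).charpoly = ((Bᵀ)⁻¹ * h * B⁻¹).charpoly := by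
    rw [← charpoly_units_conj (B.nonsingInvUnit hBu) (G⁻¹ * h)]
    congr 1
    change B * (G⁻¹ * h) * B⁻¹ = _
    rw [hB', Matrix.mul_inv_rev, Matrix.mul_assoc B⁻¹, ← Matrix.mul_assoc B B⁻¹,
      Matrix.mul_nonsing_inv _ hBu, one_mul]
  rw [key]
  exact hS.splits_charpoly

theorem det_one_add_smul_eq_sum_esymm {A : Matrix ι ι ℝ} (hA : A.charpoly.Splits) (t : ℝ) :
    (1 + t • A).det =
      ∑ j ∈ Finset.range (Fintype.card ι + 1), A.charpoly.roots.esymm j * t ^ j := by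
  have hcard : A.charpoly.roots.card = Fintype.card ι := by
    rw [Polynomial.splits_iff_card_roots.1 hA, charpoly_natDegree_eq_dim]
  rcases eq_or_ne t 0 with rfl | ht
  · rw [Finset.sum_eq_single 0] <;> simp +contextual [Multiset.esymm]
  -- For `t ≠ 0` the determinant is the characteristic polynomial at `-1/t`, rescaled by `(-t)^n`;
  -- Vieta's formula at `1/t` then expands it.
  · have h1 : (1 + t • A).det = (-t) ^ Fintype.card ι * A.charpoly.eval (-t⁻¹) := by
      rw [eval_charpoly, ← det_smul]
      congr 1
      rw [smul_sub]
      ext i j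
      by_cases hij : i = j
      · subst hij; simp [ht]
      · simp [hij]
    have h2 : A.charpoly.eval (-t⁻¹) =
        (-1) ^ Fintype.card ι * (A.charpoly.roots.map (fun r => t⁻¹ + r)).prod := by
      conv_lhs => rw [hA.eq_prod_roots, (charpoly_monic A).leadingCoeff]
      rw [← hcard]
      simp only [map_one, one_mul, Polynomial.eval_multiset_prod, Multiset.map_map,
        Function.comp_def, Polynomial.eval_sub, Polynomial.eval_X, Polynomial.eval_C]
      rw [← Multiset.card_map (fun r => t⁻¹ + r), ← Multiset.prod_map_neg]
      simp only [Multiset.map_map, Function.comp_def, neg_add, sub_eq_add_neg]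
    have h3 := congrArg (Polynomial.eval t⁻¹) (Multiset.prod_X_add_C_eq_sum_esymm A.charpoly.roots)
    simp only [Polynomial.eval_multiset_prod, Multiset.map_map, Function.comp_def,
      Polynomial.eval_add, Polynomial.eval_X, Polynomial.eval_C, Polynomial.eval_finsetSum,
      Polynomial.eval_mul, Polynomial.eval_pow, hcard] at h3
    rw [h1, h2, h3, ← mul_assoc, ← mul_pow, Finset.mul_sum]
    refine Finset.sum_congr rfl fun j hj => ?_
    have hj' : j ≤ Fintype.card ι := Nat.lt_succ_iff.1 (Finset.mem_range.1 hj)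
    obtain ⟨m, hm⟩ := Nat.exists_eq_add_of_le hj'
    rw [hm, Nat.add_sub_cancel_left, neg_mul_neg, mul_one, pow_add, inv_pow]
    field_simp

theorem esymm_roots_charpoly_eq_coeff {A : Matrix ι ι ℝ} (hA : A.charpoly.Splits) {j : ℕ}
    (hj : j ≤ Fintype.card ι) :
    A.charpoly.roots.esymm j = (-1) ^ j * A.charpoly.coeff (Fintype.card ι - j) := by
  have := Polynomial.coeff_eq_esymm_roots_of_splits hA (k := Fintype.card ι - j)
    (by rw [charpoly_natDegree_eq_dim]; omega)
  rw [this, charpoly_natDegree_eq_dim, (charpoly_monic A).leadingCoeff, Nat.sub_sub_self hj, one_mul,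
    ← mul_assoc, ← mul_pow]
  simp

/-- The coefficients are signed sums of principal minors, hence polynomials in the entries.
Continuity of the mean curvatures rests on this, with no continuous choice of eigenvalues. -/
theorem continuous_charpoly_coeff (k : ℕ) :
    Continuous fun A : Matrix ι ι ℝ => A.charpoly.coeff k := by
  rcases le_or_gt k (Fintype.card ι) with hk | hk
  · have h : ∀ A : Matrix ι ι ℝ, A.charpoly.coeff k = (-1) ^ (Fintype.card ι - k) *
        ∑ s ∈ Finset.powersetCard (Fintype.card ι - k) Finset.univ,
          (A.submatrix (Subtype.val : s → ι) Subtype.val).det := fun A => by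
      rw [← charpoly_coeff_eq_sum_minors A _ (Nat.sub_le _ _), Nat.sub_sub_self hk]
    simp only [h]
    fun_prop
  · have h : ∀ A : Matrix ι ι ℝ, A.charpoly.coeff k = 0 := fun A =>
      Polynomial.coeff_eq_zero_of_natDegree_lt (by rwa [charpoly_natDegree_eq_dim])
    simp only [h]
    exact continuous_const

end Matrix

end

/-! ### The volume form and the pointwise algebra of a hypersurface frame. -/

noncomputable section

namespace CapillaryHalfSpace

open Function

variable {n : ℕ}

/-- The volume form of `ℝ^{n+1}`. -/
def vol (n : ℕ) : EuclideanSpace ℝ (Fin (n + 1)) [⋀^Fin (n + 1)]→L[ℝ] ℝ :=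
  { Matrix.detRowAlternating.compLinearMap
      (WithLp.linearEquiv 2 ℝ (Fin (n + 1) → ℝ)).toLinearMap with
    cont := by
      change Continuous fun v : Fin (n + 1) → EuclideanSpace ℝ (Fin (n + 1)) =>
        Matrix.det (Matrix.of fun i j => v i j)
      refine Continuous.matrix_det ?_
      refine continuous_matrix fun i j => ?_
      simp only [Matrix.of_apply]
      fun_prop }

theorem vol_apply (v : Fin (n + 1) → EuclideanSpace ℝ (Fin (n + 1))) :
    vol n v = Matrix.det (Matrix.of fun i j => v i j) := rfl

/-- The volume form with its first argument split off. -/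
def vol₁ (n : ℕ) :
    EuclideanSpace ℝ (Fin (n + 1)) →L[ℝ] EuclideanSpace ℝ (Fin (n + 1)) [⋀^Fin n]→L[ℝ] ℝ :=
  (vol n).curryLeft

theorem vol₁_apply (u : EuclideanSpace ℝ (Fin (n + 1)))
    (v : Fin n → EuclideanSpace ℝ (Fin (n + 1))) :
    vol₁ n u v = vol n (Fin.cons u v : Fin (n + 1) → EuclideanSpace ℝ (Fin (n + 1))) := rfl

theorem vol_eq_zero_of_inner_eq_zero {v : Fin (n + 1) → EuclideanSpace ℝ (Fin (n + 1))}
    {w : EuclideanSpace ℝ (Fin (n + 1))} (hw : w ≠ 0) (h : ∀ i, inner ℝ w (v i) = 0) :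
    vol n v = 0 := by
  rw [vol_apply, ← Matrix.exists_mulVec_eq_zero_iff]
  refine ⟨w.ofLp, fun h0 => hw ?_, ?_⟩
  · ext i; exact congrFun h0 i
  · ext i
    have := h i
    rw [PiLp.inner_apply] at this
    simpa [Matrix.mulVec, dotProduct] using this

theorem vol₁_eq_zero_of_inner_eq_zero {u : EuclideanSpace ℝ (Fin (n + 1))}
    {v : Fin n → EuclideanSpace ℝ (Fin (n + 1))}
    {w : EuclideanSpace ℝ (Fin (n + 1))} (hw : w ≠ 0) (hu : inner ℝ w u = 0)
    (h : ∀ i, inner ℝ w (v i) = 0) : vol₁ n u v = 0 := by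
  rw [vol₁_apply]
  refine vol_eq_zero_of_inner_eq_zero hw fun i => ?_
  refine Fin.cases ?_ (fun i => ?_) i
  · simpa using hu
  · simpa using h i

theorem vol_sq (v : Fin (n + 1) → EuclideanSpace ℝ (Fin (n + 1))) :
    vol n v ^ 2 = (Matrix.gram ℝ v).det := by
  rw [vol_apply, sq]
  nth_rw 2 [← Matrix.det_transpose]
  rw [← Matrix.det_mul]
  congr 1
  ext i j
  simp [Matrix.mul_apply, Matrix.gram, PiLp.inner_apply, mul_comm]

/-- The Gram matrix of `(ν, X)` is block diagonal with blocks `1` and the Gram matrix of `X`. So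
`|vol₁ n ν X|` is the area density. -/
theorem vol₁_sq {ν : EuclideanSpace ℝ (Fin (n + 1))} {X : Fin n → EuclideanSpace ℝ (Fin (n + 1))}
    (hν : ‖ν‖ = 1) (hX : ∀ i, inner ℝ ν (X i) = 0) :
    vol₁ n ν X ^ 2 = (Matrix.gram ℝ X).det := by
  rw [vol₁_apply, vol_sq, Matrix.det_succ_row_zero, Fin.sum_univ_succ]
  rw [Finset.sum_eq_zero, add_zero]
  · have h : (Matrix.gram ℝ (Fin.cons ν X : Fin (n + 1) → EuclideanSpace ℝ (Fin (n + 1)))).submatrix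
        Fin.succ (Fin.succAbove 0) = Matrix.gram ℝ X := by
      ext i j
      simp [Matrix.gram]
    rw [h]
    simp [Matrix.gram, hν]
  · intro i _
    simp [Matrix.gram, hX]

theorem vol₁_update_comm (u v : EuclideanSpace ℝ (Fin (n + 1)))
    (a : Fin n → EuclideanSpace ℝ (Fin (n + 1))) (i : Fin n) :
    vol₁ n u (update a i v) = -vol₁ n v (update a i u) := by
  have h := (vol n).toAlternatingMap.map_swap
    (Fin.cons v (update a i u) : Fin (n + 1) → EuclideanSpace ℝ (Fin (n + 1)))
    (i := 0) (j := i.succ) (Fin.succ_ne_zero i).symm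
  rw [vol₁_apply, vol₁_apply]
  refine Eq.trans ?_ h
  change vol n _ = vol n _
  congr 1
  ext1 j
  refine Fin.cases ?_ (fun j => ?_) j
  · simp
  · by_cases hj : j = i
    · subst hj
      simp [update_of_ne (Fin.succ_ne_zero j).symm]
    · have : Equiv.swap 0 i.succ j.succ = j.succ :=
        Equiv.swap_apply_of_ne_of_ne (Fin.succ_ne_zero j) (by simpa using hj)
      simp [this, hj]

theorem vol₁_update_self (u : EuclideanSpace ℝ (Fin (n + 1)))
    (a : Fin n → EuclideanSpace ℝ (Fin (n + 1))) (i : Fin n) :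
    vol₁ n u (update a i u) = 0 := by
  have := vol₁_update_comm u u a i
  linarith

/-- The form pulled back to `ℝⁿ` along the frame is alternating of top degree, hence a multiple of
the determinant. -/
theorem vol₁_linearCombination (u : EuclideanSpace ℝ (Fin (n + 1)))
    (X : Fin n → EuclideanSpace ℝ (Fin (n + 1))) (B : Matrix (Fin n) (Fin n) ℝ) :
    vol₁ n u (fun i => ∑ j, B j i • X j) = B.det * vol₁ n u X := by
  have h := ((vol₁ n u).toAlternatingMap.compLinearMap
    (Fintype.linearCombination ℝ X)).eq_smul_basis_det (Pi.basisFun ℝ (Fin n))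
  rw [Pi.basisFun_det] at h
  have h2 := DFunLike.congr_fun h Bᵀ
  have h3 : ((vol₁ n u).toAlternatingMap.compLinearMap (Fintype.linearCombination ℝ X))
      (Pi.basisFun ℝ (Fin n)) = vol₁ n u X := by
    change vol₁ n u (fun i => Fintype.linearCombination ℝ X (Pi.basisFun ℝ (Fin n) i)) = _
    congr 1
    ext1 i
    simp [Fintype.linearCombination_apply, Pi.single_apply]
  rw [h3] at h2
  rw [mul_comm, ← Matrix.det_transpose]
  exact h2

/-- The matrix of the shape operator with tangent frame `X` and derivatives `K` of the normal. -/
def weingarten (X K : Fin n → EuclideanSpace ℝ (Fin (n + 1))) : Matrix (Fin n) (Fin n) ℝ :=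
  (Matrix.gram ℝ X)⁻¹ * Matrix.of fun i j => inner ℝ (K i) (X j)

/-- The coordinates of the tangential part of `v` in the tangent frame `X`. -/
def tangentCoords (X : Fin n → EuclideanSpace ℝ (Fin (n + 1)))
    (v : EuclideanSpace ℝ (Fin (n + 1))) : Fin n → ℝ :=
  (Matrix.gram ℝ X)⁻¹ *ᵥ fun j => inner ℝ (X j) v

/-- The elementary symmetric functions of the principal curvatures of a frame. -/
def sigma (X K : Fin n → EuclideanSpace ℝ (Fin (n + 1))) (j : ℕ) : ℝ :=
  (weingarten X K).charpoly.roots.esymm j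

/-- A unit normal `ν`, a basis `X` of its orthogonal complement, and the derivatives `K` of a unit
normal field along `X`, symmetric as required of a second fundamental form. -/
structure IsFrame (ν : EuclideanSpace ℝ (Fin (n + 1)))
    (X K : Fin n → EuclideanSpace ℝ (Fin (n + 1))) : Prop where
  norm_normal : ‖ν‖ = 1
  linearIndependent : LinearIndependent ℝ X
  inner_tangent : ∀ i, inner ℝ ν (X i) = 0
  inner_deriv : ∀ i, inner ℝ ν (K i) = 0
  symm : ∀ i j, inner ℝ (K i) (X j) = inner ℝ (K j) (X i)

namespace IsFrame

variable {ν : EuclideanSpace ℝ (Fin (n + 1))} {X K : Fin n → EuclideanSpace ℝ (Fin (n + 1))}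

theorem posDef_gram (h : IsFrame ν X K) : (Matrix.gram ℝ X).PosDef :=
  Matrix.posDef_gram_of_linearIndependent h.linearIndependent

theorem isUnit_det_gram (h : IsFrame ν X K) : IsUnit (Matrix.gram ℝ X).det :=
  (Matrix.isUnit_iff_isUnit_det _).1 h.posDef_gram.isUnit

theorem isSymm_gram (X : Fin n → EuclideanSpace ℝ (Fin (n + 1))) : (Matrix.gram ℝ X).IsSymm := by
  ext i j
  simp [Matrix.gram, real_inner_comm]

theorem vol₁_ne_zero (h : IsFrame ν X K) : vol₁ n ν X ≠ 0 := by
  intro h0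
  have := vol₁_sq h.norm_normal h.inner_tangent
  rw [h0] at this
  exact h.isUnit_det_gram.ne_zero (by rw [← this]; norm_num)

theorem sqrt_det_gram (h : IsFrame ν X K) :
    Real.sqrt (Matrix.gram ℝ X).det = |vol₁ n ν X| := by
  rw [← vol₁_sq h.norm_normal h.inner_tangent, Real.sqrt_sq_eq_abs]

theorem inner_sum_tangentCoords (h : IsFrame ν X K) (v : EuclideanSpace ℝ (Fin (n + 1)))
    (i : Fin n) : inner ℝ (X i) (∑ j, tangentCoords X v j • X j) = inner ℝ (X i) v := by
  have h1 : Matrix.gram ℝ X *ᵥ tangentCoords X v = fun j => inner ℝ (X j) v := by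
    rw [tangentCoords, Matrix.mulVec_mulVec, Matrix.mul_nonsing_inv _ h.isUnit_det_gram,
      Matrix.one_mulVec]
  have h2 := congrFun h1 i
  rw [← h2, inner_sum]
  simp [Matrix.mulVec, dotProduct, Matrix.gram, inner_smul_right, mul_comm]

/-- The difference of the two sides is orthogonal to `ν` and to every `X i`. Were it nonzero, the
volume of `(ν, X)` would vanish. -/
theorem eq_normal_add_sum (h : IsFrame ν X K) (v : EuclideanSpace ℝ (Fin (n + 1))) :
    v = inner ℝ ν v • ν + ∑ j, tangentCoords X v j • X j := by
  by_contra hne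
  set w := v - (inner ℝ ν v • ν + ∑ j, tangentCoords X v j • X j) with hw
  have hw0 : w ≠ 0 := fun h0 => hne (sub_eq_zero.1 h0)
  refine h.vol₁_ne_zero (vol₁_eq_zero_of_inner_eq_zero hw0 ?_ fun i => ?_)
  · rw [real_inner_comm, hw, inner_sub_right, inner_add_right, inner_smul_right, inner_sum,
      real_inner_self_eq_norm_sq, h.norm_normal, Finset.sum_eq_zero]
    · ring
    · intro j _
      rw [inner_smul_right, h.inner_tangent, mul_zero]
  · rw [real_inner_comm, hw, inner_sub_right, inner_add_right, inner_smul_right,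
      h.inner_sum_tangentCoords, real_inner_comm ν (X i), h.inner_tangent, real_inner_comm v]
    ring

theorem tangentCoords_deriv (h : IsFrame ν X K) (i j : Fin n) :
    tangentCoords X (K i) j = weingarten X K j i := by
  simp only [tangentCoords, weingarten, Matrix.mulVec, dotProduct, Matrix.mul_apply,
    Matrix.of_apply]
  refine Finset.sum_congr rfl fun l _ => ?_
  rw [h.symm l i, real_inner_comm]

theorem deriv_eq_sum (h : IsFrame ν X K) (i : Fin n) : K i = ∑ j, weingarten X K j i • X j := by
  conv_lhs => rw [h.eq_normal_add_sum (K i), h.inner_deriv, zero_smul, zero_add]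
  simp only [h.tangentCoords_deriv]

theorem add_smul_deriv_eq_sum (h : IsFrame ν X K) (t : ℝ) (i : Fin n) :
    X i + t • K i = ∑ j, (1 + t • weingarten X K) j i • X j := by
  conv_lhs => rw [h.deriv_eq_sum i]
  simp [add_smul, Finset.sum_add_distrib, Finset.smul_sum, smul_smul, Matrix.one_apply]

theorem splits (h : IsFrame ν X K) : (weingarten X K).charpoly.Splits :=
  Matrix.splits_charpoly_inv_mul h.posDef_gram
    (by ext i j; simp [h.symm i j])

theorem sigma_eq_coeff (h : IsFrame ν X K) {j : ℕ} (hj : j ≤ n) :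
    sigma X K j = (-1) ^ j * (weingarten X K).charpoly.coeff (n - j) := by
  have := Matrix.esymm_roots_charpoly_eq_coeff h.splits (j := j) (by simpa using hj)
  rwa [Fintype.card_fin] at this

theorem vol₁_parallel (h : IsFrame ν X K) (t : ℝ) :
    vol₁ n ν (fun i => X i + t • K i) =
      vol₁ n ν X * ∑ j ∈ Finset.range (n + 1), sigma X K j * t ^ j := by
  simp_rw [h.add_smul_deriv_eq_sum t]
  rw [vol₁_linearCombination, Matrix.det_one_add_smul_eq_sum_esymm h.splits, Fintype.card_fin,
    mul_comm]
  rfl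

/-- Cramer's rule: in the frame `X` the arguments form the matrix `1 + tA` with column `i` replaced
by the coordinates of `v`; the normal part of `v` repeats `ν` and contributes nothing. -/
theorem vol₁_parallel_update (h : IsFrame ν X K) (t : ℝ) (i : Fin n)
    (v : EuclideanSpace ℝ (Fin (n + 1))) :
    vol₁ n ν (update (fun i => X i + t • K i) i v) =
      vol₁ n ν X * ((1 + t • weingarten X K).adjugate *ᵥ tangentCoords X v) i := by
  conv_lhs => rw [h.eq_normal_add_sum v]
  rw [ContinuousAlternatingMap.map_update_add, ContinuousAlternatingMap.map_update_smul,
    vol₁_update_self, smul_zero, zero_add, ← Matrix.cramer_eq_adjugate_mulVec,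
    Matrix.cramer_apply, mul_comm, ← vol₁_linearCombination]
  congr 1
  ext1 l
  by_cases hl : l = i
  · subst hl
    simp
  · simp [hl, h.add_smul_deriv_eq_sum t]

/-- Since `K i` and the remaining arguments are tangent, only the normal part of `v` contributes.
Exchanging `ν` with `K i` produces the sign. -/
theorem vol₁_deriv_update (h : IsFrame ν X K) (t : ℝ) (i : Fin n)
    (v : EuclideanSpace ℝ (Fin (n + 1))) :
    vol₁ n (K i) (update (fun i => X i + t • K i) i v) =
      -(inner ℝ ν v * vol₁ n ν (update (fun i => X i + t • K i) i (K i))) := by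
  have hν : ν ≠ 0 := by
    rintro rfl
    simpa using h.norm_normal
  conv_lhs => rw [h.eq_normal_add_sum v]
  rw [ContinuousAlternatingMap.map_update_add, ContinuousAlternatingMap.map_update_smul,
    vol₁_update_comm (K i) ν]
  rw [vol₁_eq_zero_of_inner_eq_zero (w := ν) hν (h.inner_deriv i)]
  · simp
  · intro j
    by_cases hj : j = i
    · subst hj
      simp [inner_sum, inner_smul_right, h.inner_tangent]
    · simp [hj, inner_add_right, inner_smul_right, h.inner_tangent, h.inner_deriv]

/-- Both sides are the derivative at `t` of `vol₁ n ν (X + tK)`: one by multilinearity, the other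
from the expansion of `vol₁_parallel`. -/
theorem sum_vol₁_update_deriv (h : IsFrame ν X K) (t : ℝ) :
    ∑ i, vol₁ n ν (update (fun i => X i + t • K i) i (K i)) =
      vol₁ n ν X * ∑ j ∈ Finset.range n, (j + 1) * sigma X K (j + 1) * t ^ j := by
  have h1 : HasDerivAt (fun s : ℝ => vol₁ n ν (fun i => X i + s • K i))
      (∑ i, vol₁ n ν (update (fun i => X i + t • K i) i (K i))) t := by
    have hlin : HasDerivAt (fun (s : ℝ) (i : Fin n) => X i + s • K i) K t := by
      rw [hasDerivAt_pi]
      intro i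
      simpa using ((hasDerivAt_id t).smul_const (K i)).const_add (X i)
    have := ((vol₁ n ν).hasFDerivAt (fun i => X i + t • K i)).comp_hasDerivAt t hlin
    convert! this using 1
    exact (ContinuousMultilinearMap.linearDeriv_apply _ _ _).symm
  have h2 : HasDerivAt (fun s : ℝ => vol₁ n ν (fun i => X i + s • K i))
      (vol₁ n ν X * ∑ j ∈ Finset.range n, (j + 1) * sigma X K (j + 1) * t ^ j) t := by
    simp_rw [h.vol₁_parallel]
    refine HasDerivAt.const_mul _ ?_
    have : ∑ j ∈ Finset.range n, ((j : ℝ) + 1) * sigma X K (j + 1) * t ^ j =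
        ∑ j ∈ Finset.range (n + 1), sigma X K j * (j * t ^ (j - 1)) := by
      rw [Finset.sum_range_succ']
      simp only [Nat.cast_zero, zero_mul, mul_zero, add_zero]
      refine Finset.sum_congr rfl fun j _ => ?_
      push_cast
      ring
    rw [this]
    exact HasDerivAt.fun_sum fun j _ => (hasDerivAt_pow j t).const_mul _
  exact h1.unique h2

/-- Substituting `X i = (X i + t K i) - t K i`, each slot gives the full volume minus `t` times a
summand of the preceding identity. Summed, the coefficient of `t^j` is `n σ_j - j σ_j`. -/
theorem sum_vol₁_update_tangent (h : IsFrame ν X K) (t : ℝ) :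
    ∑ i, vol₁ n ν (update (fun i => X i + t • K i) i (X i)) =
      vol₁ n ν X * ∑ j ∈ Finset.range n, (n - j) * sigma X K j * t ^ j := by
  have h1 : ∀ i, vol₁ n ν (update (fun i => X i + t • K i) i (X i)) =
      vol₁ n ν (fun i => X i + t • K i) -
        t * vol₁ n ν (update (fun i => X i + t • K i) i (K i)) := by
    intro i
    have : X i = (X i + t • K i) + (-t) • K i := by simp
    conv_lhs => rw [this]
    rw [ContinuousAlternatingMap.map_update_add, ContinuousAlternatingMap.map_update_smul,
      update_eq_self i (fun i => X i + t • K i)]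
    simp [sub_eq_add_neg]
  simp_rw [h1]
  rw [Finset.sum_sub_distrib, ← Finset.mul_sum, h.sum_vol₁_update_deriv, h.vol₁_parallel]
  simp only [Finset.sum_const, Finset.card_univ, Fintype.card_fin, nsmul_eq_mul]
  have h2 : ∑ j ∈ Finset.range n, ((n : ℝ) - j) * sigma X K j * t ^ j =
      ∑ j ∈ Finset.range (n + 1), ((n : ℝ) - j) * sigma X K j * t ^ j := by
    rw [Finset.sum_range_succ]; simp
  have h3 : t * ∑ j ∈ Finset.range n, ((j : ℝ) + 1) * sigma X K (j + 1) * t ^ j =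
      ∑ j ∈ Finset.range (n + 1), (j : ℝ) * sigma X K j * t ^ j := by
    rw [Finset.sum_range_succ', Finset.mul_sum]
    simp only [Nat.cast_zero, zero_mul, add_zero]
    refine Finset.sum_congr rfl fun j _ => ?_
    push_cast
    ring
  rw [h2, mul_left_comm t, h3, mul_left_comm, ← mul_sub, Finset.mul_sum, ← Finset.sum_sub_distrib]
  congr 1
  refine Finset.sum_congr rfl fun j _ => ?_
  ring

theorem inner_deriv_eq_dotProduct (h : IsFrame ν X K) (i : Fin n)
    (u : EuclideanSpace ℝ (Fin (n + 1))) :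
    inner ℝ (K i) u = ((Matrix.of fun i j => inner ℝ (K i) (X j)) *ᵥ tangentCoords X u) i := by
  conv_lhs => rw [h.eq_normal_add_sum u]
  rw [inner_add_right, inner_smul_right, real_inner_comm ν (K i), h.inner_deriv, mul_zero, zero_add,
    inner_sum]
  simp [Matrix.mulVec, dotProduct, inner_smul_right, mul_comm]

/-- Up to the factor `vol₁ n ν X`, the sum is the bilinear form `uᵀ H adj (1 + tA) v` in tangential
coordinates, and `H adj (1 + tA)` is symmetric. -/
theorem sum_inner_deriv_mul_vol₁_comm (h : IsFrame ν X K) (t : ℝ)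
    (u v : EuclideanSpace ℝ (Fin (n + 1))) :
    ∑ i, inner ℝ (K i) u * vol₁ n ν (update (fun i => X i + t • K i) i v) =
      ∑ i, inner ℝ (K i) v * vol₁ n ν (update (fun i => X i + t • K i) i u) := by
  simp_rw [h.vol₁_parallel_update, h.inner_deriv_eq_dotProduct _ u,
    h.inner_deriv_eq_dotProduct _ v]
  simp only [mul_left_comm _ (vol₁ n ν X)]
  rw [← Finset.mul_sum, ← Finset.mul_sum]
  congr 1
  set H : Matrix (Fin n) (Fin n) ℝ := Matrix.of fun i j => inner ℝ (K i) (X j) with hH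
  have hHs : H.IsSymm := by ext i j; simp [hH, h.symm i j]
  have hS : (H * (1 + t • weingarten X K).adjugate).IsSymm :=
    Matrix.isSymm_mul_adjugate_one_add (isSymm_gram X) h.isUnit_det_gram hHs t
  set Q := (1 + t • weingarten X K).adjugate
  have key : ∀ a b : Fin n → ℝ, (H *ᵥ a) ⬝ᵥ (Q *ᵥ b) = a ⬝ᵥ ((H * Q) *ᵥ b) := by
    intro a b
    rw [← Matrix.mulVec_mulVec, Matrix.dotProduct_mulVec a, ← Matrix.mulVec_transpose, hHs.eq]
  change (H *ᵥ _) ⬝ᵥ (Q *ᵥ _) = (H *ᵥ _) ⬝ᵥ (Q *ᵥ _)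
  rw [key, key, Matrix.dotProduct_mulVec, ← Matrix.mulVec_transpose, hS.eq, dotProduct_comm]

end IsFrame

/-- The capillary test field `x + cos θ (⟨ν, e⟩ x - ⟨x, ν⟩ e)`, with `c = cos θ`. -/
def capillaryField (c : ℝ) (e x ν : EuclideanSpace ℝ (Fin (n + 1))) :
    EuclideanSpace ℝ (Fin (n + 1)) :=
  x + c • (inner ℝ ν e • x - inner ℝ x ν • e)

/-- The generating function, in `t`, of the integrands of the Minkowski formulas. -/
def minkowskiIntegrand (c : ℝ) (e x ν : EuclideanSpace ℝ (Fin (n + 1)))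
    (X K : Fin n → EuclideanSpace ℝ (Fin (n + 1))) (t : ℝ) : ℝ :=
  ∑ j ∈ Finset.range n, ((n - j) * (sigma X K j * (1 + c * inner ℝ ν e)) -
    (j + 1) * (sigma X K (j + 1) * inner ℝ x ν)) * t ^ j

/-- The vector inserted in the second term is the derivative of `capillaryField` along `X i`,
simplified by `⟨X i, ν⟩ = 0`. Its part `⟨K i, e⟩ x - ⟨x, K i⟩ e` sums to zero by symmetry. The first
term sees only `⟨Y, ν⟩`, which equals `⟨x, ν⟩` because the correction multiplied by `c` is
orthogonal to `ν`. -/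
theorem IsFrame.sum_vol₁_capillaryField {ν : EuclideanSpace ℝ (Fin (n + 1))}
    {X K : Fin n → EuclideanSpace ℝ (Fin (n + 1))} (h : IsFrame ν X K) (c t : ℝ)
    (e x : EuclideanSpace ℝ (Fin (n + 1))) :
    ∑ i, (vol₁ n (K i) (update (fun i => X i + t • K i) i (capillaryField c e x ν)) +
      vol₁ n ν (update (fun i => X i + t • K i) i
        (X i + c • ((inner ℝ ν e • X i + inner ℝ (K i) e • x) - inner ℝ x (K i) • e)))) =
      vol₁ n ν X * minkowskiIntegrand c e x ν X K t := by
  have hY : inner ℝ ν (capillaryField c e x ν) = inner ℝ x ν := by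
    simp only [capillaryField, inner_add_right, inner_smul_right, inner_sub_right,
      real_inner_comm x ν]
    ring
  have h1 : ∀ i, vol₁ n ν (update (fun i => X i + t • K i) i
        (X i + c • ((inner ℝ ν e • X i + inner ℝ (K i) e • x) - inner ℝ x (K i) • e))) =
      (1 + c * inner ℝ ν e) * vol₁ n ν (update (fun i => X i + t • K i) i (X i)) +
      c * (inner ℝ (K i) e * vol₁ n ν (update (fun i => X i + t • K i) i x) -
        inner ℝ (K i) x * vol₁ n ν (update (fun i => X i + t • K i) i e)) := by
    intro i
    simp only [ContinuousAlternatingMap.map_update_add, ContinuousAlternatingMap.map_update_smul,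
      ContinuousAlternatingMap.map_update_sub, smul_eq_mul, real_inner_comm (K i) x]
    ring
  simp_rw [h1, h.vol₁_deriv_update, hY]
  simp only [Finset.sum_add_distrib, ← Finset.mul_sum, Finset.sum_sub_distrib,
    Finset.sum_neg_distrib]
  rw [h.sum_inner_deriv_mul_vol₁_comm t e x, h.sum_vol₁_update_deriv, h.sum_vol₁_update_tangent,
    minkowskiIntegrand, sub_self, mul_zero, add_zero, mul_left_comm, mul_left_comm (_ + _),
    neg_add_eq_sub, ← mul_sub, Finset.mul_sum, Finset.mul_sum, ← Finset.sum_sub_distrib]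
  congr 1
  refine Finset.sum_congr rfl fun j _ => ?_
  ring

end CapillaryHalfSpace

end

/-! ### Change of frame, and the divergence theorem on the half-space. -/

noncomputable section

namespace CapillaryHalfSpace

open Function

variable {n : ℕ}

section ChangeOfFrame

variable {X X' K K' : Fin n → EuclideanSpace ℝ (Fin (n + 1))} {B : Matrix (Fin n) (Fin n) ℝ}

theorem inner_matrix_eq_of_eq_sum {Y Y' : Fin n → EuclideanSpace ℝ (Fin (n + 1))}
    (hX : ∀ i, X i = ∑ j, B j i • X' j) (hY : ∀ i, Y i = ∑ j, B j i • Y' j) :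
    (Matrix.of fun i j => (inner ℝ (Y i) (X j) : ℝ)) =
      Bᵀ * (Matrix.of fun i j => (inner ℝ (Y' i) (X' j) : ℝ)) * B := by
  ext i j
  simp only [Matrix.of_apply, hX, hY, Matrix.mul_apply, Matrix.transpose_apply, inner_sum,
    sum_inner, inner_smul_left, inner_smul_right, Finset.sum_mul, RCLike.conj_to_real]
  refine Finset.sum_congr rfl fun k _ => ?_
  rw [Finset.mul_sum]
  refine Finset.sum_congr rfl fun l _ => ?_
  ring

theorem gram_eq_of_eq_sum (hX : ∀ i, X i = ∑ j, B j i • X' j) :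
    Matrix.gram ℝ X = Bᵀ * Matrix.gram ℝ X' * B :=
  inner_matrix_eq_of_eq_sum hX hX

theorem weingarten_eq_of_eq_sum (hB : IsUnit B.det) (hX : ∀ i, X i = ∑ j, B j i • X' j)
    (hK : ∀ i, K i = ∑ j, B j i • K' j) : weingarten X K = B⁻¹ * weingarten X' K' * B := by
  have hBt : IsUnit Bᵀ.det := by rwa [Matrix.det_transpose]
  rw [weingarten, weingarten, gram_eq_of_eq_sum hX, inner_matrix_eq_of_eq_sum hX hK,
    Matrix.mul_inv_rev, Matrix.mul_inv_rev]
  simp only [Matrix.mul_assoc]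
  rw [Matrix.nonsing_inv_mul_cancel_left _ _ hBt]

/-- A change of frame conjugates the Weingarten matrix, so its characteristic polynomial is
unchanged. -/
theorem sigma_eq_of_eq_sum (hB : IsUnit B.det) (hX : ∀ i, X i = ∑ j, B j i • X' j)
    (hK : ∀ i, K i = ∑ j, B j i • K' j) (j : ℕ) : sigma X K j = sigma X' K' j := by
  have : (weingarten X K).charpoly = (weingarten X' K').charpoly := by
    rw [weingarten_eq_of_eq_sum hB hX hK,
      ← Matrix.charpoly_units_conj (B.nonsingInvUnit hB)⁻¹ (weingarten X' K'), Matrix.coe_units_inv,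
      Matrix.nonsing_inv_nonsing_inv]
    · rfl
    · exact hB
  rw [sigma, sigma, this]

theorem minkowskiIntegrand_eq_of_eq_sum (hB : IsUnit B.det) (hX : ∀ i, X i = ∑ j, B j i • X' j)
    (hK : ∀ i, K i = ∑ j, B j i • K' j) (c : ℝ) (e x ν : EuclideanSpace ℝ (Fin (n + 1))) (t : ℝ) :
    minkowskiIntegrand c e x ν X K t = minkowskiIntegrand c e x ν X' K' t := by
  simp only [minkowskiIntegrand, sigma_eq_of_eq_sum hB hX hK]

/-- The coordinates, in the frame `X`, of the vector `adj (1 + t A) v`, with `v` replaced by its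
tangential part. -/
def newtonCoords (X K : Fin n → EuclideanSpace ℝ (Fin (n + 1))) (t : ℝ)
    (v : EuclideanSpace ℝ (Fin (n + 1))) : Fin n → ℝ :=
  (1 + t • weingarten X K).adjugate *ᵥ tangentCoords X v

theorem tangentCoords_eq_of_eq_sum (hB : IsUnit B.det) (hX : ∀ i, X i = ∑ j, B j i • X' j)
    (v : EuclideanSpace ℝ (Fin (n + 1))) :
    B *ᵥ tangentCoords X v = tangentCoords X' v := by
  have hBt : IsUnit Bᵀ.det := by rwa [Matrix.det_transpose]
  have hv : (fun j => (inner ℝ (X j) v : ℝ)) = Bᵀ *ᵥ fun j => (inner ℝ (X' j) v : ℝ) := by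
    ext j
    simp [hX, Matrix.mulVec, dotProduct, sum_inner, inner_smul_left]
  rw [tangentCoords, tangentCoords, hv, gram_eq_of_eq_sum hX, Matrix.mulVec_mulVec,
    Matrix.mulVec_mulVec, Matrix.mul_inv_rev, Matrix.mul_inv_rev]
  simp only [Matrix.mul_assoc]
  rw [Matrix.nonsing_inv_mul _ hBt, Matrix.mul_nonsing_inv_cancel_left _ _ hB, Matrix.mul_one]

/-- The adjugate is compatible with conjugation, so these coordinates transform like those of a
vector. This is what makes the tangent field of the divergence identity well defined on `M`. -/
theorem newtonCoords_eq_of_eq_sum (hB : IsUnit B.det) (hX : ∀ i, X i = ∑ j, B j i • X' j)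
    (hK : ∀ i, K i = ∑ j, B j i • K' j) (t : ℝ) (v : EuclideanSpace ℝ (Fin (n + 1))) :
    B *ᵥ newtonCoords X K t v = newtonCoords X' K' t v := by
  have h1 : 1 + t • weingarten X K = B⁻¹ * ((1 + t • weingarten X' K') * B) := by
    rw [weingarten_eq_of_eq_sum hB hX hK, add_mul, mul_add, one_mul, Matrix.nonsing_inv_mul _ hB,
      Matrix.mul_assoc]
    simp
  have h2 : B * (1 + t • weingarten X K).adjugate = (1 + t • weingarten X' K').adjugate * B := by
    have h3 : B.adjugate * B⁻¹.adjugate = 1 := by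
      rw [← Matrix.adjugate_mul_distrib, Matrix.nonsing_inv_mul _ hB, Matrix.adjugate_one]
    have h4 : B * B.adjugate * ((1 + t • weingarten X' K').adjugate * (B⁻¹.adjugate * B⁻¹)) * B =
        (1 + t • weingarten X' K').adjugate * B := by
      rw [Matrix.mul_adjugate, Matrix.adjugate_mul]
      simp [smul_smul, hB.ne_zero]
    rw [h1, Matrix.adjugate_mul_distrib, Matrix.adjugate_mul_distrib, ← h4]
    simp only [Matrix.mul_assoc]
    rw [Matrix.nonsing_inv_mul _ hB, Matrix.mul_one]
  rw [newtonCoords, newtonCoords, Matrix.mulVec_mulVec, h2, ← Matrix.mulVec_mulVec,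
    tangentCoords_eq_of_eq_sum hB hX]

end ChangeOfFrame

section HalfSpace

/-- Derivatives are required only in the open half-space, since that is where a chart of a manifold
with boundary gives ordinary derivatives. Only the normal component `f 0` must vanish on the
boundary, because the other components contribute no flux there. -/
theorem setIntegral_halfSpace_divergence_eq_zero [NeZero n]
    (f : Fin n → EuclideanSpace ℝ (Fin n) → ℝ)
    (f' : Fin n → EuclideanSpace ℝ (Fin n) → EuclideanSpace ℝ (Fin n) →L[ℝ] ℝ)
    {C : Set (EuclideanSpace ℝ (Fin n))} (hC : IsCompact C)
    (hf : ∀ i, ContinuousOn (f i) {y | 0 ≤ y 0})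
    (hf0 : ∀ i, ∀ y ∉ C, f i y = 0) (hf'0 : ∀ i, ∀ y ∉ C, f' i y = 0)
    (hd : ∀ i, ∀ y : EuclideanSpace ℝ (Fin n), 0 < y 0 → HasFDerivAt (f i) (f' i y) y)
    (hb : ∀ y : EuclideanSpace ℝ (Fin n), y 0 = 0 → f 0 y = 0)
    (hi : IntegrableOn (fun y => ∑ i, f' i y (EuclideanSpace.single i 1)) {y | 0 ≤ y 0}) :
    ∫ y in {y : EuclideanSpace ℝ (Fin n) | 0 ≤ y 0},
      ∑ i, f' i y (EuclideanSpace.single i 1) = 0 := by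
  obtain ⟨m, rfl⟩ : ∃ m, n = m + 1 := Nat.exists_eq_succ_of_ne_zero (NeZero.ne n)
  obtain ⟨R, hR0, hR⟩ : ∃ R : ℝ, 0 < R ∧ ∀ y ∈ C, ∀ i, |y i| < R := by
    obtain ⟨r, hr⟩ := hC.isBounded.exists_norm_le
    refine ⟨max r 0 + 1, by positivity, fun y hy i => ?_⟩
    calc |y i| ≤ ‖y‖ := PiLp.norm_apply_le y i
      _ ≤ r := hr y hy
      _ < max r 0 + 1 := by linarith [le_max_left r 0]
  set L := EuclideanSpace.equiv (Fin (m + 1)) ℝ with hL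
  have hmp : MeasurePreserving L volume volume :=
    EuclideanSpace.volume_preserving_symm_measurableEquiv_toLp (Fin (m + 1)) |>.symm |>.symm
  have hemb : MeasurableEmbedding L := L.toHomeomorph.measurableEmbedding
  -- The box is `[0, R] × [-R, R]^m`. By the choice of `R` all its faces miss `C`, except possibly
  -- the one on `y 0 = 0`.
  set a : Fin (m + 1) → ℝ := Fin.cons 0 fun _ => -R with ha
  set b : Fin (m + 1) → ℝ := fun _ => R with hb'
  have hab : a ≤ b := by
    intro i
    refine Fin.cases ?_ (fun i => ?_) i <;> simp [ha, hb'] <;> linarith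
  have hsub : L ⁻¹' Set.Icc a b ⊆ {y | 0 ≤ y 0} := fun y hy => by
    have := hy.1 0
    exact this
  have hrest : ∀ y ∈ {y : EuclideanSpace ℝ (Fin (m + 1)) | 0 ≤ y 0} \ L ⁻¹' Set.Icc a b,
      ∑ i, f' i y (EuclideanSpace.single i 1) = 0 := by
    rintro y ⟨hy0, hy⟩
    have hyC : y ∉ C := fun hyC => hy ⟨fun i => ?_, fun i => ?_⟩
    · simp [hf'0 _ y hyC]
    · have := hR y hyC i
      revert this
      refine Fin.cases (fun _ => ?_) (fun i h => ?_) i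
      · exact hy0
      · exact (abs_lt.1 h).1.le
    · exact (abs_lt.1 (hR y hyC i)).2.le
  have hmeas : MeasurableSet {y : EuclideanSpace ℝ (Fin (m + 1)) | 0 ≤ y 0} :=
    (isClosed_le continuous_const (by fun_prop)).measurableSet
  rw [setIntegral_eq_of_subset_of_forall_sdiff_eq_zero hmeas hsub hrest]
  have h1 : ∫ y in L ⁻¹' Set.Icc a b, ∑ i, f' i y (EuclideanSpace.single i 1) =
      ∫ z in Set.Icc a b, ∑ i, (f' i (L.symm z) ∘L (L.symm : (Fin (m + 1) → ℝ) →L[ℝ] _))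
        (Pi.single i 1) := by
    rw [← hmp.setIntegral_preimage_emb hemb]
    simp [hL]
  rw [h1, integral_divergence_of_hasFDerivAt_off_countable' a b hab
    (fun i z => f i (L.symm z)) (fun i z => f' i (L.symm z) ∘L (L.symm : (Fin (m + 1) → ℝ) →L[ℝ] _))
    ∅ Set.countable_empty]
  · refine Finset.sum_eq_zero fun i _ => ?_
    have hfront : ∀ z, f i (L.symm (i.insertNth (b i) z)) = 0 := fun z => hf0 i _ fun hz => by
      have := hR _ hz i
      simp [hL, hb', abs_of_pos hR0] at this
    have hback : ∀ z, f i (L.symm (i.insertNth (a i) z)) = 0 := by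
      intro z
      rcases eq_or_ne i 0 with rfl | hi0
      · exact hb _ (by simp [hL, ha])
      · refine hf0 i _ fun hz => ?_
        have := hR _ hz i
        obtain ⟨j, rfl⟩ := Fin.exists_succ_eq.2 hi0
        simp [hL, ha, abs_of_pos hR0] at this
    simp [hfront, hback]
  · intro i
    refine (hf i).comp L.symm.continuous.continuousOn fun z hz => ?_
    exact hsub (by simpa using hz)
  · rintro z ⟨hz, -⟩ i
    refine (hd i (L.symm z) ?_).comp z L.symm.hasFDerivAt
    have := (hz 0 (Set.mem_univ _)).1
    simpa [ha, hL] using this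
  · have := hi.mono_set hsub
    rw [← hmp.integrableOn_comp_preimage hemb]
    refine this.congr_fun (fun y _ => ?_) (hemb.measurable measurableSet_Icc)
    simp [hL]
    rfl

end HalfSpace

end CapillaryHalfSpace

end

/-! ### The divergence of the determinant field, and parametrized capillary hypersurfaces. -/

noncomputable section

namespace CapillaryHalfSpace

open Function Set Filter Topology

variable {n : ℕ}

/-- The divergence of the vector field with components `Ω(N; a_1, …, Y, …, a_n)`, where `a_j` are
vector fields whose derivatives satisfy `∂_i a_j = ∂_j a_i`. -/
theorem hasFDerivAt_vol₁_update {N Y : EuclideanSpace ℝ (Fin n) → EuclideanSpace ℝ (Fin (n + 1))}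
    {a : Fin n → EuclideanSpace ℝ (Fin n) → EuclideanSpace ℝ (Fin (n + 1))}
    {N' Y' : EuclideanSpace ℝ (Fin n) →L[ℝ] EuclideanSpace ℝ (Fin (n + 1))}
    {a' : Fin n → EuclideanSpace ℝ (Fin n) →L[ℝ] EuclideanSpace ℝ (Fin (n + 1))}
    {y : EuclideanSpace ℝ (Fin n)} (hN : HasFDerivAt N N' y) (hY : HasFDerivAt Y Y' y)
    (ha : ∀ i, HasFDerivAt (a i) (a' i) y)
    (hs : ∀ i j, a' i (EuclideanSpace.single j 1) = a' j (EuclideanSpace.single i 1)) :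
    ∃ W' : Fin n → EuclideanSpace ℝ (Fin n) →L[ℝ] ℝ,
      (∀ i, HasFDerivAt (fun z => vol₁ n (N z) (update (fun j => a j z) i (Y z))) (W' i) y) ∧
      ∑ i, W' i (EuclideanSpace.single i 1) =
        ∑ i, (vol₁ n (N' (EuclideanSpace.single i 1)) (update (fun j => a j y) i (Y y)) +
          vol₁ n (N y) (update (fun j => a j y) i (Y' (EuclideanSpace.single i 1)))) := by
  have hg : ∀ i j, HasFDerivAt (fun z => update (fun j => a j z) i (Y z) j)
      (update a' i Y' j) y := by
    intro i j
    by_cases hj : j = i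
    · subst hj; simpa using hY
    · simpa [hj] using ha j
  have hNc : HasFDerivAt (fun z => vol₁ n (N z)) (vol₁ n ∘L N') y :=
    (vol₁ n).hasFDerivAt.comp y hN
  refine ⟨_, fun i => hNc.continuousAlternatingMap_apply (hg i), ?_⟩
  -- The slot `j = i` carries the derivative of `Y`; the slots `j ≠ i` carry the derivatives of the
  -- `a_j`.
  have hterm : ∀ i j, vol₁ n (N y) (update (update (fun k => a k y) i (Y y)) j
        (update a' i Y' j (EuclideanSpace.single i 1))) =
      (if j = i then vol₁ n (N y) (update (fun j => a j y) i (Y' (EuclideanSpace.single i 1)))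
        else 0) +
      (if j = i then 0 else vol₁ n (N y) (update (update (fun k => a k y) i (Y y)) j
        (a' j (EuclideanSpace.single i 1)))) := by
    intro i j
    by_cases hj : j = i
    · subst hj; simp
    · simp [hj]
  set T : Fin n → Fin n → ℝ := fun i j => if j = i then 0 else
    vol₁ n (N y) (update (update (fun k => a k y) i (Y y)) j
      (a' j (EuclideanSpace.single i 1))) with hT
  -- `T i j` has `Y` in slot `i` and `∂_i a_j` in slot `j`; `T j i` has `Y` in slot `j` and `∂_j a_i
  -- = ∂_i a_j` in slot `i`. They differ by one transposition of arguments.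
  have hanti : ∀ i j, T i j = -T j i := by
    intro i j
    by_cases hj : j = i
    · subst hj; simp [hT]
    · have hj' : i ≠ j := fun h => hj h.symm
      simp only [hT, if_neg hj, if_neg hj']
      rw [hs i j]
      have := (vol₁ n (N y)).toAlternatingMap.map_swap
        (update (update (fun k => a k y) j (Y y)) i (a' j (EuclideanSpace.single i 1))) hj'
      refine Eq.trans ?_ this
      change vol₁ n (N y) _ = vol₁ n (N y) _
      congr 1
      ext1 k
      by_cases hki : k = i
      · subst hki; simp [update_of_ne hj, update_of_ne hj']
      · by_cases hkj : k = j
        · subst hkj; simp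
        · simp [Equiv.swap_apply_of_ne_of_ne hki hkj, hki, hkj]
  have hzero : ∑ i, ∑ j, T i j = 0 := by
    have : ∑ i, ∑ j, T i j = -∑ i, ∑ j, T i j := by
      conv_lhs => rw [Finset.sum_comm]
      simp only [← Finset.sum_neg_distrib]
      exact Finset.sum_congr rfl fun i _ => Finset.sum_congr rfl fun j _ => hanti j i
    linarith
  have hL : ∀ i, ((ContinuousAlternatingMap.apply ℝ _ ℝ
        fun j => update (fun j => a j y) i (Y y) j) ∘L (vol₁ n ∘L N') +
        ∑ j, (vol₁ n (N y)).toContinuousLinearMap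
          (fun j => update (fun j => a j y) i (Y y) j) j ∘L update a' i Y' j)
        (EuclideanSpace.single i 1) =
      vol₁ n (N' (EuclideanSpace.single i 1)) (update (fun j => a j y) i (Y y)) +
      ∑ j, vol₁ n (N y) (update (update (fun k => a k y) i (Y y)) j
        (update a' i Y' j (EuclideanSpace.single i 1))) := by
    intro i
    rw [_root_.add_apply, _root_.sum_apply]
    rfl
  rw [Finset.sum_congr rfl fun i _ => hL i]
  simp_rw [hterm]
  rw [Finset.sum_add_distrib, Finset.sum_add_distrib]
  congr 1
  simp only [Finset.sum_add_distrib]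
  rw [hzero, add_zero]
  simp

variable [NeZero n]

theorem mem_range_iff {y : EuclideanSpace ℝ (Fin n)} : y ∈ range (𝓡∂ n) ↔ 0 ≤ y 0 := by
  rw [range_modelWithCornersEuclideanHalfSpace]; rfl

/-- The partial derivatives, within the half-space, of a function on the half-space. -/
def pderiv {F : Type*} [NormedAddCommGroup F] [NormedSpace ℝ F]
    (f : EuclideanSpace ℝ (Fin n) → F) (y : EuclideanSpace ℝ (Fin n)) (i : Fin n) : F :=
  fderivWithin ℝ f (range (𝓡∂ n)) y (EuclideanSpace.single i 1)

/-- A parametrized capillary hypersurface with normal `N` over a relatively open subset `U` of the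
half-space. -/
structure IsLocalSurface (c : ℝ) (e : EuclideanSpace ℝ (Fin (n + 1)))
    (U : Set (EuclideanSpace ℝ (Fin n)))
    (X N : EuclideanSpace ℝ (Fin n) → EuclideanSpace ℝ (Fin (n + 1))) : Prop where
  subset_range : U ⊆ range (𝓡∂ n)
  mem_nhdsWithin : ∀ y ∈ U, U ∈ 𝓝[range (𝓡∂ n)] y
  measurableSet : MeasurableSet U
  smooth : ContDiffOn ℝ ∞ X U
  smooth_normal : ContDiffOn ℝ ∞ N U
  frame : ∀ y ∈ U, IsFrame (N y) (pderiv X y) (pderiv N y)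
  norm_dir : ‖e‖ = 1
  sq_lt_one : c ^ 2 < 1
  inner_boundary : ∀ y ∈ U, y 0 = 0 → inner ℝ e (X y) = 0
  inner_normal_boundary : ∀ y ∈ U, y 0 = 0 → inner ℝ e (N y) = -c

section Regularity

variable {F : Type*} [NormedAddCommGroup F] [NormedSpace ℝ F] {f : EuclideanSpace ℝ (Fin n) → F}
  {U : Set (EuclideanSpace ℝ (Fin n))} {y : EuclideanSpace ℝ (Fin n)}

theorem contDiffWithinAt_range (hU : ∀ y ∈ U, U ∈ 𝓝[range (𝓡∂ n)] y) (hf : ContDiffOn ℝ ∞ f U)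
    (hy : y ∈ U) : ContDiffWithinAt ℝ ∞ f (range (𝓡∂ n)) y :=
  (hf y hy).mono_of_mem_nhdsWithin (hU y hy)

theorem contDiffOn_fderivWithin_range (hUs : U ⊆ range (𝓡∂ n))
    (hU : ∀ y ∈ U, U ∈ 𝓝[range (𝓡∂ n)] y) (hf : ContDiffOn ℝ ∞ f U) :
    ContDiffOn ℝ ∞ (fderivWithin ℝ f (range (𝓡∂ n))) U := fun y hy =>
  ((contDiffWithinAt_range hU hf hy).fderivWithin_right (𝓡∂ n).uniqueDiffOn (by simp)
    (hUs hy)).mono hUs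

theorem continuousOn_pderiv (hUs : U ⊆ range (𝓡∂ n))
    (hU : ∀ y ∈ U, U ∈ 𝓝[range (𝓡∂ n)] y) (hf : ContDiffOn ℝ ∞ f U) (i : Fin n) :
    ContinuousOn (fun y => pderiv f y i) U :=
  (contDiffOn_fderivWithin_range hUs hU hf).continuousOn.clm_apply continuousOn_const

theorem range_mem_nhds (hy : 0 < y 0) : range (𝓡∂ n) ∈ 𝓝 y := by
  rw [range_modelWithCornersEuclideanHalfSpace]
  have ho : IsOpen {z : EuclideanSpace ℝ (Fin n) | 0 < z 0} :=
    isOpen_lt continuous_const (by fun_prop)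
  exact mem_of_superset (ho.mem_nhds hy) fun z (hz : 0 < z 0) => hz.le

/-- Symmetry of second derivatives persists at boundary points because the half-space lies in the
closure of its interior. -/
theorem pderiv_comm_inner (hUs : U ⊆ range (𝓡∂ n))
    (hU : ∀ y ∈ U, U ∈ 𝓝[range (𝓡∂ n)] y) (hf : ContDiffOn ℝ ∞ f U) (hy : y ∈ U) (i j : Fin n) :
    fderivWithin ℝ (fderivWithin ℝ f (range (𝓡∂ n))) (range (𝓡∂ n)) y
      (EuclideanSpace.single i 1) (EuclideanSpace.single j 1) =
    fderivWithin ℝ (fderivWithin ℝ f (range (𝓡∂ n))) (range (𝓡∂ n)) y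
      (EuclideanSpace.single j 1) (EuclideanSpace.single i 1) := by
  refine (contDiffWithinAt_range hU hf hy).isSymmSndFDerivWithinAt
    (n := ∞) ?_ (𝓡∂ n).uniqueDiffOn ?_ (hUs hy) _ _
  · simp only [minSmoothness_of_isRCLikeNormedField]
    exact WithTop.coe_le_coe.2 (le_top : (2 : ℕ∞) ≤ ⊤)
  · exact (𝓡∂ n).range_subset_closure_interior (hUs hy)

end Regularity

/-- The second fundamental form is symmetric. -/
theorem inner_pderiv_symm {U : Set (EuclideanSpace ℝ (Fin n))}
    {X N : EuclideanSpace ℝ (Fin n) → EuclideanSpace ℝ (Fin (n + 1))}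
    (hUs : U ⊆ range (𝓡∂ n)) (hU : ∀ y ∈ U, U ∈ 𝓝[range (𝓡∂ n)] y)
    (hX : ContDiffOn ℝ ∞ X U) (hN : ContDiffOn ℝ ∞ N U)
    (h : ∀ y ∈ U, ∀ i, inner ℝ (N y) (pderiv X y i) = 0) {y : EuclideanSpace ℝ (Fin n)}
    (hy : y ∈ U) (i j : Fin n) :
    inner ℝ (pderiv N y i) (pderiv X y j) = inner ℝ (pderiv N y j) (pderiv X y i) := by
  -- Differentiating `⟨N, ∂_j X⟩ = 0` in direction `i` turns the second fundamental form into second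
  -- derivatives of `X`.
  have key : ∀ i j, inner ℝ (pderiv N y i) (pderiv X y j) = -inner ℝ (N y)
      (fderivWithin ℝ (fderivWithin ℝ X (range (𝓡∂ n))) (range (𝓡∂ n)) y
      (EuclideanSpace.single i 1) (EuclideanSpace.single j 1)) := by
    intro i j
    have h1 : HasFDerivWithinAt N (fderivWithin ℝ N (range (𝓡∂ n)) y) (range (𝓡∂ n)) y :=
      ((contDiffWithinAt_range hU hN hy).differentiableWithinAt (by simp)).hasFDerivWithinAt
    have h2 : HasFDerivWithinAt (fderivWithin ℝ X (range (𝓡∂ n)))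
        (fderivWithin ℝ (fderivWithin ℝ X (range (𝓡∂ n))) (range (𝓡∂ n)) y) (range (𝓡∂ n)) y :=
      ((contDiffWithinAt_range hU (contDiffOn_fderivWithin_range hUs hU hX)
        hy).differentiableWithinAt (by simp)).hasFDerivWithinAt
    have h3 := h2.clm_apply (hasFDerivWithinAt_const (EuclideanSpace.single j (1 : ℝ)) y _)
    have h4 := h1.inner ℝ h3
    have h5 : HasFDerivWithinAt (fun z => (inner ℝ (N z)
        (fderivWithin ℝ X (range (𝓡∂ n)) z (EuclideanSpace.single j 1)) : ℝ))
        (0 : EuclideanSpace ℝ (Fin n) →L[ℝ] ℝ) (range (𝓡∂ n)) y := by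
      refine (hasFDerivWithinAt_const (0 : ℝ) y _).congr_of_eventuallyEq ?_ (h y hy j)
      filter_upwards [hU y hy] with z hz
      exact h z hz j
    have h6 := ((𝓡∂ n).uniqueDiffOn y (hUs hy)).eq h4 h5
    have h7 := DFunLike.congr_fun h6 (EuclideanSpace.single i 1)
    simp only [ContinuousLinearMap.comp_apply, fderivInnerCLM_apply,
      ContinuousLinearMap.prod_apply, _root_.add_apply, ContinuousLinearMap.flip_apply,
      _root_.zero_apply, map_zero, zero_add] at h7
    exact eq_neg_of_add_eq_zero_right h7
  rw [key i j, key j i, pderiv_comm_inner hUs hU hX hy]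

end CapillaryHalfSpace

end

/-! ### Continuity of the curvature quantities, and the divergence identity in one chart. -/

noncomputable section

namespace CapillaryHalfSpace

open Function Set Filter Topology

variable {n : ℕ}

theorem continuousOn_vol₁ {E : Type*} [TopologicalSpace E] {s : Set E}
    {u : E → EuclideanSpace ℝ (Fin (n + 1))} {v : E → Fin n → EuclideanSpace ℝ (Fin (n + 1))}
    (hu : ContinuousOn u s) (hv : ∀ i, ContinuousOn (fun y => v y i) s) :
    ContinuousOn (fun y => vol₁ n (u y) (v y)) s := by
  refine (vol n).cont.comp_continuousOn (continuousOn_pi.2 fun i => ?_)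
  refine Fin.cases ?_ (fun i => ?_) i
  · simpa using hu
  · simpa using hv i

theorem continuousOn_vol₁_update {E : Type*} [TopologicalSpace E] {s : Set E}
    {u w : E → EuclideanSpace ℝ (Fin (n + 1))} {v : E → Fin n → EuclideanSpace ℝ (Fin (n + 1))}
    (hu : ContinuousOn u s) (hv : ∀ i, ContinuousOn (fun y => v y i) s) (hw : ContinuousOn w s)
    (i : Fin n) : ContinuousOn (fun y => vol₁ n (u y) (update (v y) i (w y))) s := by
  refine continuousOn_vol₁ hu fun j => ?_
  by_cases hj : j = i
  · subst hj; simpa using hw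
  · simpa [hj] using hv j

theorem continuousOn_gram {E : Type*} [TopologicalSpace E] {s : Set E}
    {X : E → Fin n → EuclideanSpace ℝ (Fin (n + 1))} (hX : ∀ i, ContinuousOn (fun y => X y i) s) :
    ContinuousOn (fun y => Matrix.gram ℝ (X y)) s :=
  continuousOn_pi.2 fun i => continuousOn_pi.2 fun j => (hX i).inner (hX j)

theorem continuousOn_sigma {E : Type*} [TopologicalSpace E] {s : Set E}
    {ν : E → EuclideanSpace ℝ (Fin (n + 1))} {X K : E → Fin n → EuclideanSpace ℝ (Fin (n + 1))}
    (h : ∀ y ∈ s, IsFrame (ν y) (X y) (K y)) (hX : ∀ i, ContinuousOn (fun y => X y i) s)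
    (hK : ∀ i, ContinuousOn (fun y => K y i) s) {j : ℕ} (hj : j ≤ n) :
    ContinuousOn (fun y => sigma (X y) (K y) j) s := by
  have hG := continuousOn_gram hX
  have hinv : ContinuousOn (fun y => (Matrix.gram ℝ (X y))⁻¹) s := by
    have heq : (fun y => (Matrix.gram ℝ (X y))⁻¹) = fun y =>
        (Matrix.gram ℝ (X y)).det⁻¹ • (Matrix.gram ℝ (X y)).adjugate := by
      ext1 y
      rw [Matrix.inv_def, Ring.inverse_eq_inv']
    rw [heq]
    refine ContinuousOn.smul (ContinuousOn.inv₀ ?_ fun y hy => (h y hy).isUnit_det_gram.ne_zero) ?_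
    · exact (continuous_id.matrix_det).comp_continuousOn hG
    · exact (continuous_id.matrix_adjugate).comp_continuousOn hG
  have hA : ContinuousOn (fun y => weingarten (X y) (K y)) s := by
    have hH : ContinuousOn
        (fun y => (Matrix.of fun i j => inner ℝ (K y i) (X y j) : Matrix (Fin n) (Fin n) ℝ)) s :=
      continuousOn_pi.2 fun i => continuousOn_pi.2 fun j => (hK i).inner (hX j)
    exact (continuous_fst.matrix_mul continuous_snd).comp_continuousOn (hinv.prodMk hH)
  refine ContinuousOn.congr ?_ fun y hy => (h y hy).sigma_eq_coeff hj
  exact continuousOn_const.mul ((Matrix.continuous_charpoly_coeff _).comp_continuousOn hA)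

/-- Cramer's rule exhibits each coordinate as a quotient of two continuous volumes with nonvanishing
denominator. -/
theorem continuousOn_newtonCoords {E : Type*} [TopologicalSpace E] {s : Set E}
    {ν v : E → EuclideanSpace ℝ (Fin (n + 1))} {X K : E → Fin n → EuclideanSpace ℝ (Fin (n + 1))}
    (h : ∀ y ∈ s, IsFrame (ν y) (X y) (K y)) (hν : ContinuousOn ν s)
    (hX : ∀ i, ContinuousOn (fun y => X y i) s)
    (hK : ∀ i, ContinuousOn (fun y => K y i) s) (hv : ContinuousOn v s) (t : ℝ) (i : Fin n) :
    ContinuousOn (fun y => newtonCoords (X y) (K y) t (v y) i) s := by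
  have heq : ∀ y ∈ s, newtonCoords (X y) (K y) t (v y) i =
      vol₁ n (ν y) (update (fun i => X y i + t • K y i) i (v y)) / vol₁ n (ν y) (X y) := by
    intro y hy
    rw [(h y hy).vol₁_parallel_update, mul_div_cancel_left₀ _ (h y hy).vol₁_ne_zero]
    rfl
  refine ContinuousOn.congr ?_ heq
  refine ContinuousOn.div (continuousOn_vol₁_update hν (fun j => ?_) hv i)
    (continuousOn_vol₁ hν hX) fun y hy => (h y hy).vol₁_ne_zero
  exact (hX j).add ((hK j).const_smul t)

theorem eventually_sign_eq {E : Type*} {l : Filter E} {f : E → ℝ} {a : ℝ}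
    (hf : Tendsto f l (𝓝 a)) (ha : a ≠ 0) : ∀ᶠ z in l, Real.sign (f z) = Real.sign a := by
  rcases ha.lt_or_gt with h | h
  · filter_upwards [hf.eventually_lt_const h] with z hz
    rw [Real.sign_of_neg hz, Real.sign_of_neg h]
  · filter_upwards [hf.eventually_const_lt h] with z hz
    rw [Real.sign_of_pos hz, Real.sign_of_pos h]

theorem integrableOn_of_continuousOn_of_eq_zero {E : Type*} [TopologicalSpace E] [T2Space E]
    [MeasurableSpace E] [OpensMeasurableSpace E] {μ : Measure E} [IsFiniteMeasureOnCompacts μ]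
    {f : E → ℝ} {s C : Set E} (hs : MeasurableSet s) (hf : ContinuousOn f s) (hC : IsCompact C)
    (hCs : C ⊆ s) (h0 : ∀ y ∈ s, y ∉ C → f y = 0) : IntegrableOn f s μ :=
  ((hf.mono hCs).integrableOn_compact hC).of_forall_sdiff_eq_zero hs fun y hy => h0 y hy.1 hy.2

variable [NeZero n]

theorem pderiv_eq_zero_of_eq_zero {ψ : EuclideanSpace ℝ (Fin n) → ℝ}
    {U C : Set (EuclideanSpace ℝ (Fin n))} (hU : ∀ y ∈ U, U ∈ 𝓝[range (𝓡∂ n)] y)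
    (hC : IsClosed C) (h0 : ∀ y ∈ U, y ∉ C → ψ y = 0) {y : EuclideanSpace ℝ (Fin n)}
    (hy : y ∈ U) (hyC : y ∉ C) (i : Fin n) : pderiv ψ y i = 0 := by
  have h1 : ψ =ᶠ[𝓝[range (𝓡∂ n)] y] fun _ => 0 := by
    filter_upwards [hU y hy, mem_nhdsWithin_of_mem_nhds (hC.isOpen_compl.mem_nhds hyC)] with z hz hz'
    exact h0 z hz hz'
  rw [pderiv, h1.fderivWithin_eq (h0 y hy hyC)]
  simp

namespace IsLocalSurface

variable {c : ℝ} {e : EuclideanSpace ℝ (Fin (n + 1))}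
  {U : Set (EuclideanSpace ℝ (Fin n))}
  {X N : EuclideanSpace ℝ (Fin n) → EuclideanSpace ℝ (Fin (n + 1))}

theorem continuousOn_tangent (h : IsLocalSurface c e U X N) (i : Fin n) :
    ContinuousOn (fun y => pderiv X y i) U :=
  continuousOn_pderiv h.subset_range h.mem_nhdsWithin h.smooth i

theorem continuousOn_deriv_normal (h : IsLocalSurface c e U X N) (i : Fin n) :
    ContinuousOn (fun y => pderiv N y i) U :=
  continuousOn_pderiv h.subset_range h.mem_nhdsWithin h.smooth_normal i

theorem continuousOn_jacobian (h : IsLocalSurface c e U X N) :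
    ContinuousOn (fun y => vol₁ n (N y) (pderiv X y)) U :=
  continuousOn_vol₁ h.smooth_normal.continuousOn h.continuousOn_tangent

theorem continuousOn_capillaryField (h : IsLocalSurface c e U X N) :
    ContinuousOn (fun y => capillaryField c e (X y) (N y)) U := by
  have hX := h.smooth.continuousOn
  have hN := h.smooth_normal.continuousOn
  have h1 : ContinuousOn (fun y => (inner ℝ (N y) e : ℝ) • X y) U :=
    (hN.inner (𝕜 := ℝ) (continuousOn_const (c := e))).smul hX
  have h2 : ContinuousOn (fun y => (inner ℝ (X y) (N y) : ℝ) • e) U :=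
    (hX.inner (𝕜 := ℝ) hN).smul (continuousOn_const (c := e))
  exact hX.add ((h1.sub h2).const_smul c)

/-- The components `√g V^i` (up to sign) of the vector field in the divergence identity. -/
def flux (c : ℝ) (e : EuclideanSpace ℝ (Fin (n + 1)))
    (X N : EuclideanSpace ℝ (Fin n) → EuclideanSpace ℝ (Fin (n + 1))) (t : ℝ) (i : Fin n)
    (y : EuclideanSpace ℝ (Fin n)) : ℝ :=
  vol₁ n (N y) (update (fun j => pderiv X y j + t • pderiv N y j) i
    (capillaryField c e (X y) (N y)))

theorem flux_eq (h : IsLocalSurface c e U X N) (t : ℝ) (i : Fin n) {y : EuclideanSpace ℝ (Fin n)}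
    (hy : y ∈ U) : flux c e X N t i y = vol₁ n (N y) (pderiv X y) *
      newtonCoords (pderiv X y) (pderiv N y) t (capillaryField c e (X y) (N y)) i :=
  (h.frame y hy).vol₁_parallel_update t i _

theorem continuousOn_flux (h : IsLocalSurface c e U X N) (t : ℝ) (i : Fin n) :
    ContinuousOn (flux c e X N t i) U := by
  refine continuousOn_vol₁_update h.smooth_normal.continuousOn (fun j => ?_)
    h.continuousOn_capillaryField i
  exact (h.continuousOn_tangent j).add ((h.continuousOn_deriv_normal j).const_smul t)

/-- At points of the open half-space, derivatives within it are ordinary ones, so the divergence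
computation applies and the frame algebra evaluates the result. -/
theorem exists_hasFDerivAt_flux (h : IsLocalSurface c e U X N) (t : ℝ)
    {y : EuclideanSpace ℝ (Fin n)} (hy : y ∈ U) (hy0 : 0 < y 0) :
    ∃ W' : Fin n → EuclideanSpace ℝ (Fin n) →L[ℝ] ℝ,
      (∀ i, HasFDerivAt (flux c e X N t i) (W' i) y) ∧
      ∑ i, W' i (EuclideanSpace.single i 1) = vol₁ n (N y) (pderiv X y) *
        minkowskiIntegrand c e (X y) (N y) (pderiv X y) (pderiv N y) t := by
  have hd : ∀ {F : Type} [NormedAddCommGroup F] [NormedSpace ℝ F]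
      {f : EuclideanSpace ℝ (Fin n) → F}, ContDiffOn ℝ ∞ f U →
      HasFDerivAt f (fderivWithin ℝ f (range (𝓡∂ n)) y) y := fun hf =>
    (((contDiffWithinAt_range h.mem_nhdsWithin hf hy).differentiableWithinAt
      (by simp)).hasFDerivWithinAt).hasFDerivAt (range_mem_nhds hy0)
  have hX := hd h.smooth
  have hN := hd h.smooth_normal
  have hX2 := hd (contDiffOn_fderivWithin_range h.subset_range h.mem_nhdsWithin h.smooth)
  have hN2 := hd (contDiffOn_fderivWithin_range h.subset_range h.mem_nhdsWithin h.smooth_normal)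
  have hY := hX.add ((((hN.inner ℝ (hasFDerivAt_const e y)).smul hX).sub
    ((hX.inner ℝ hN).smul_const e)).const_smul c)
  have ha : ∀ i : Fin n, HasFDerivAt (fun z => pderiv X z i + t • pderiv N z i) _ y := fun i =>
    (hX2.clm_apply (hasFDerivAt_const (EuclideanSpace.single i (1 : ℝ)) y)).add
      ((hN2.clm_apply (hasFDerivAt_const (EuclideanSpace.single i (1 : ℝ)) y)).const_smul t)
  obtain ⟨W', hW, hsum⟩ := hasFDerivAt_vol₁_update hN hY ha (by
    intro i j
    have h1 := pderiv_comm_inner h.subset_range h.mem_nhdsWithin h.smooth hy i j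
    have h2 := pderiv_comm_inner h.subset_range h.mem_nhdsWithin h.smooth_normal hy i j
    simp only [_root_.add_apply, _root_.smul_apply, ContinuousLinearMap.flip_apply,
      ContinuousLinearMap.comp_apply, _root_.zero_apply, map_zero, zero_add, h1, h2])
  refine ⟨W', hW, hsum.trans ?_⟩
  rw [← (h.frame y hy).sum_vol₁_capillaryField c t e (X y)]
  refine Finset.sum_congr rfl fun i _ => ?_
  congr 3
  -- Orthogonality removes one of the two terms in the derivative of `⟨X, N⟩`, leaving the form
  -- expected by `IsFrame.sum_vol₁_capillaryField`.
  have hXN : inner ℝ (pderiv X y i) (N y) = 0 := by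
    rw [real_inner_comm]; exact (h.frame y hy).inner_tangent i
  have hXN' : inner ℝ (fderivWithin ℝ X (range (𝓡∂ n)) y (EuclideanSpace.single i 1)) (N y) = 0 :=
    hXN
  simp only [_root_.add_apply, _root_.smul_apply, _root_.sub_apply, ContinuousLinearMap.comp_apply,
    ContinuousLinearMap.prod_apply, fderivInnerCLM_apply, ContinuousLinearMap.smulRight_apply,
    _root_.zero_apply, inner_zero_right, zero_add, hXN', add_zero]
  rfl

/-- For `j ≠ 0` the line through `y` in direction `j` stays in the boundary hyperplane, where `⟨e,
f⟩` is constant. -/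
theorem inner_pderiv_eq_zero {f : EuclideanSpace ℝ (Fin n) → EuclideanSpace ℝ (Fin (n + 1))}
    (hU : ∀ y ∈ U, U ∈ 𝓝[range (𝓡∂ n)] y) (hf : ContDiffOn ℝ ∞ f U) {b : ℝ}
    (hb : ∀ y ∈ U, y 0 = 0 → inner ℝ e (f y) = b) {y : EuclideanSpace ℝ (Fin n)} (hy : y ∈ U)
    (hy0 : y 0 = 0) {j : Fin n} (hj : j ≠ 0) : inner ℝ e (pderiv f y j) = 0 := by
  set l : ℝ → EuclideanSpace ℝ (Fin n) := fun s => y + s • EuclideanSpace.single j 1 with hl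
  have hl0 : l 0 = y := by simp [hl]
  have hls : ∀ s, (l s) 0 = 0 := fun s => by simp [hl, hy0, hj.symm]
  have hld : HasDerivAt l (EuclideanSpace.single j 1) 0 := by
    simpa [hl] using ((hasDerivAt_id (0 : ℝ)).smul_const
      (EuclideanSpace.single j (1 : ℝ))).const_add y
  have hlr : ∀ s, l s ∈ range (𝓡∂ n) := fun s => mem_range_iff.2 (hls s).ge
  have hfd : HasFDerivWithinAt f (fderivWithin ℝ f (range (𝓡∂ n)) y) (range (𝓡∂ n)) (l 0) := by
    rw [hl0]
    exact ((contDiffWithinAt_range hU hf hy).differentiableWithinAt (by simp)).hasFDerivWithinAt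
  have h1 : HasDerivAt (fun s => f (l s)) (pderiv f y j) 0 := by
    have := hfd.comp_hasDerivWithinAt (s := univ) 0 hld.hasDerivWithinAt fun s _ => hlr s
    exact hasDerivWithinAt_univ.1 this
  have h2 : HasDerivAt (fun s => (inner ℝ e (f (l s)) : ℝ)) (inner ℝ e (pderiv f y j)) 0 := by
    simpa using (hasDerivAt_const (0 : ℝ) e).inner ℝ h1
  have h3 : HasDerivAt (fun s => (inner ℝ e (f (l s)) : ℝ)) 0 0 := by
    refine (hasDerivAt_const (0 : ℝ) b).congr_of_eventuallyEq ?_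
    have : Tendsto l (𝓝 0) (𝓝[range (𝓡∂ n)] y) := by
      refine tendsto_nhdsWithin_iff.2 ⟨?_, Eventually.of_forall hlr⟩
      rw [← hl0]
      exact hld.continuousAt
    filter_upwards [this (hU y hy)] with s hs
    exact hb _ hs (hls s)
  exact h2.unique h3

/-- This is where the contact angle enters. At the boundary `N`, `Y` and the vectors `∂_j X + t ∂_j
N` with `j ≠ 0` are `n + 1` vectors in the hyperplane orthogonal to `e + cN`, so their volume is
zero. -/
theorem flux_boundary (h : IsLocalSurface c e U X N) (t : ℝ)
    {y : EuclideanSpace ℝ (Fin n)} (hy : y ∈ U) (hy0 : y 0 = 0) : flux c e X N t 0 y = 0 := by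
  have hF := h.frame y hy
  have heX := h.inner_boundary y hy hy0
  have heN := h.inner_normal_boundary y hy hy0
  have hNe : inner ℝ (N y) e = -c := by rw [real_inner_comm]; exact heN
  have hXN := real_inner_comm (X y) (N y)
  have hee : inner ℝ e e = (1 : ℝ) := by rw [real_inner_self_eq_norm_sq, h.norm_dir]; norm_num
  have hNN : inner ℝ (N y) (N y) = (1 : ℝ) := by
    rw [real_inner_self_eq_norm_sq, hF.norm_normal]; norm_num
  refine vol₁_eq_zero_of_inner_eq_zero (w := e + c • N y) ?_ ?_ fun j => ?_
  -- The squared norm of `e + cN` is `1 - c²`, which is positive.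
  · intro h0
    have h1 : inner ℝ (e + c • N y) (e + c • N y) = (0 : ℝ) := by rw [h0, inner_zero_left]
    simp only [inner_add_left, inner_add_right, inner_smul_left, inner_smul_right, hee, hNN, heN,
      hNe, RCLike.conj_to_real] at h1
    have := h.sq_lt_one
    nlinarith
  · simp only [inner_add_left, inner_smul_left, heN, hNN, RCLike.conj_to_real]
    ring
  · by_cases hj : j = 0
    · subst hj
      simp only [update_self, capillaryField, inner_add_left, inner_add_right, inner_smul_left,
        inner_smul_right, inner_sub_right, heX, hNe, hee, RCLike.conj_to_real, hXN]
      ring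
    · have h1 := inner_pderiv_eq_zero h.mem_nhdsWithin h.smooth h.inner_boundary
        hy hy0 hj
      have h2 := inner_pderiv_eq_zero h.mem_nhdsWithin h.smooth_normal
        h.inner_normal_boundary hy hy0 hj
      simp only [update_of_ne hj, inner_add_left, inner_add_right, inner_smul_left,
        inner_smul_right, h1, h2, hF.inner_tangent, hF.inner_deriv]
      simp

theorem continuousOn_minkowskiIntegrand (h : IsLocalSurface c e U X N) (t : ℝ) :
    ContinuousOn (fun y =>
      minkowskiIntegrand c e (X y) (N y) (pderiv X y) (pderiv N y) t) U := by
  have hX := h.smooth.continuousOn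
  have hN := h.smooth_normal.continuousOn
  have hs : ∀ j ≤ n, ContinuousOn (fun y => sigma (pderiv X y) (pderiv N y) j) U := fun j hj =>
    continuousOn_sigma h.frame h.continuousOn_tangent h.continuousOn_deriv_normal hj
  refine continuousOn_finsetSum _ fun j hj => ?_
  have hj' := Finset.mem_range.1 hj
  exact ((continuousOn_const.mul ((hs j hj'.le).mul (continuousOn_const.add
    (continuousOn_const.mul (hN.inner continuousOn_const))))).sub
    (continuousOn_const.mul ((hs (j + 1) hj').mul (hX.inner hN)))).mul continuousOn_const

/-- Divergence theorem for `ψ` times the flux: the product rule gives `ψ` times the Minkowski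
integrand plus the derivative of `ψ` along the tangent field. -/
theorem setIntegral_divergence_eq_zero (h : IsLocalSurface c e U X N) (t : ℝ)
    {ψ : EuclideanSpace ℝ (Fin n) → ℝ} (hψ : ContDiffOn ℝ ∞ ψ U)
    {C : Set (EuclideanSpace ℝ (Fin n))} (hC : IsCompact C) (hCU : C ⊆ U)
    (hψ0 : ∀ y ∈ U, y ∉ C → ψ y = 0) :
    ∫ y in U, |vol₁ n (N y) (pderiv X y)| *
      (ψ y * minkowskiIntegrand c e (X y) (N y) (pderiv X y) (pderiv N y) t +
        ∑ i, pderiv ψ y i *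
          newtonCoords (pderiv X y) (pderiv N y) t (capillaryField c e (X y) (N y)) i) = 0 := by
  set D : EuclideanSpace ℝ (Fin n) → ℝ := fun y => vol₁ n (N y) (pderiv X y) with hD
  set G : EuclideanSpace ℝ (Fin n) → ℝ := fun y => |D y| *
      (ψ y * minkowskiIntegrand c e (X y) (N y) (pderiv X y) (pderiv N y) t +
        ∑ i, pderiv ψ y i *
          newtonCoords (pderiv X y) (pderiv N y) t (capillaryField c e (X y) (N y)) i) with hG
  have hGc : ContinuousOn G U := by
    refine h.continuousOn_jacobian.abs.mul ((hψ.continuousOn.mul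
      (h.continuousOn_minkowskiIntegrand t)).add (continuousOn_finsetSum _ fun i _ => ?_))
    exact (continuousOn_pderiv h.subset_range h.mem_nhdsWithin hψ i).mul
      (continuousOn_newtonCoords h.frame h.smooth_normal.continuousOn h.continuousOn_tangent
        h.continuousOn_deriv_normal h.continuousOn_capillaryField t i)
  have hG0 : ∀ y ∈ U, y ∉ C → G y = 0 := by
    intro y hy hyC
    simp only [hG, hψ0 y hy hyC,
      pderiv_eq_zero_of_eq_zero h.mem_nhdsWithin hC.isClosed hψ0 hy hyC]
    simp
  have hGi : IntegrableOn G U :=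
    integrableOn_of_continuousOn_of_eq_zero h.measurableSet hGc hC hCU hG0
  -- The chart need not be compatible with the orientation given by `N`. The sign of the Jacobian
  -- `D` is locally constant and turns `D` into the area density `|D|`. Extension by zero outside
  -- `U` is harmless because `ψ` vanishes off the compact set `C`.
  set f : Fin n → EuclideanSpace ℝ (Fin n) → ℝ := fun i =>
    U.indicator fun y => Real.sign (D y) * (ψ y * flux c e X N t i y) with hf
  have hf0 : ∀ i, ∀ y ∉ C, f i y = 0 := by
    intro i y hy
    by_cases hyU : y ∈ U
    · simp [hf, hyU, hψ0 y hyU hy]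
    · simp [hf, hyU]
  have hfev : ∀ i, ∀ y ∉ C, f i =ᶠ[𝓝 y] fun _ => 0 := by
    intro i y hy
    filter_upwards [hC.isClosed.isOpen_compl.mem_nhds hy] with z hz
    exact hf0 i z hz
  have hf'0 : ∀ i, ∀ y ∉ C, fderiv ℝ (f i) y = 0 := by
    intro i y hy
    rw [(hfev i y hy).fderiv_eq]
    simp
  have hloc : ∀ i, ∀ y ∈ U, f i =ᶠ[𝓝[range (𝓡∂ n)] y]
      fun z => Real.sign (D y) * (ψ z * flux c e X N t i z) := by
    intro i y hy
    have hDt : Tendsto D (𝓝[range (𝓡∂ n)] y) (𝓝 (D y)) :=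
      ((h.continuousOn_jacobian y hy).mono_of_mem_nhdsWithin (h.mem_nhdsWithin y hy))
    filter_upwards [h.mem_nhdsWithin y hy,
      eventually_sign_eq hDt (h.frame y hy).vol₁_ne_zero] with z hz hz'
    simp [hf, hz, hz']
  have hfc : ∀ i, ContinuousOn (f i) (range (𝓡∂ n)) := by
    intro i y hy
    by_cases hyU : y ∈ U
    · have h1 : ContinuousWithinAt (fun z => Real.sign (D y) * (ψ z * flux c e X N t i z))
          (range (𝓡∂ n)) y :=
        (continuousOn_const.mul (hψ.continuousOn.mul (h.continuousOn_flux t i)) y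
          hyU).mono_of_mem_nhdsWithin (h.mem_nhdsWithin y hyU)
      exact h1.congr_of_eventuallyEq (hloc i y hyU) ((hloc i y hyU).self_of_nhdsWithin hy)
    · have hyC : y ∉ C := fun h' => hyU (hCU h')
      exact (continuousAt_const.congr (hfev i y hyC).symm).continuousWithinAt
  have hderiv : ∀ y ∈ U, 0 < y 0 → (∀ i, DifferentiableAt ℝ (f i) y) ∧
      ∑ i, fderiv ℝ (f i) y (EuclideanSpace.single i 1) = G y := by
    intro y hy hy0
    obtain ⟨W', hW, hsum⟩ := h.exists_hasFDerivAt_flux t hy hy0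
    have hψd : HasFDerivAt ψ (fderivWithin ℝ ψ (range (𝓡∂ n)) y) y :=
      (((contDiffWithinAt_range h.mem_nhdsWithin hψ hy).differentiableWithinAt
        (by simp)).hasFDerivWithinAt).hasFDerivAt (range_mem_nhds hy0)
    have h1 : ∀ i, HasFDerivAt (f i) (Real.sign (D y) • (ψ y • W' i +
        flux c e X N t i y • fderivWithin ℝ ψ (range (𝓡∂ n)) y)) y := by
      intro i
      refine ((hψd.mul (hW i)).const_mul _).congr_of_eventuallyEq ?_
      have := hloc i y hy
      rwa [nhdsWithin_eq_nhds.2 (range_mem_nhds hy0)] at this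
    refine ⟨fun i => (h1 i).differentiableAt, ?_⟩
    have h2 : ∀ i, fderiv ℝ (f i) y (EuclideanSpace.single i 1) = Real.sign (D y) *
        (ψ y * W' i (EuclideanSpace.single i 1) + D y * (pderiv ψ y i *
          newtonCoords (pderiv X y) (pderiv N y) t (capillaryField c e (X y) (N y)) i)) := by
      intro i
      rw [(h1 i).fderiv, _root_.smul_apply, _root_.add_apply, _root_.smul_apply,
        _root_.smul_apply, h.flux_eq t i hy]
      simp only [smul_eq_mul, pderiv, hD]
      ring
    have hsgn : Real.sign (D y) * D y = |D y| := by
      rcases lt_trichotomy (D y) 0 with h' | h' | h'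
      · rw [Real.sign_of_neg h', abs_of_neg h']; ring
      · simp [h']
      · rw [Real.sign_of_pos h', abs_of_pos h']; ring
    simp_rw [h2]
    rw [← Finset.mul_sum, Finset.sum_add_distrib, ← Finset.mul_sum, ← Finset.mul_sum, hsum]
    change Real.sign (D y) * (ψ y * (D y * _) + D y * _) = |D y| * _
    rw [← hsgn]
    ring
  have hmeas : MeasurableSet (range (𝓡∂ n)) := (𝓡∂ n).isClosed_range.measurableSet
  -- The boundary hyperplane is a null set, so it suffices to know the divergence at interior
  -- points.
  have hae : ∀ᵐ y ∂(volume.restrict (range (𝓡∂ n))),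
      ∑ i, fderiv ℝ (f i) y (EuclideanSpace.single i 1) = U.indicator G y := by
    have hfr : volume (frontier (range (𝓡∂ n))) = 0 := (𝓡∂ n).convex_range.addHaar_frontier _
    rw [ae_restrict_iff' hmeas]
    filter_upwards [measure_eq_zero_iff_ae_notMem.1 hfr] with y hy hyr
    by_cases hyU : y ∈ U
    · have hy0 : 0 < y 0 := by
        rw [frontier_range_modelWithCornersEuclideanHalfSpace] at hy
        exact lt_of_le_of_ne (mem_range_iff.1 hyr) hy
      rw [(hderiv y hyU hy0).2, indicator_of_mem hyU]
    · rw [indicator_of_notMem hyU]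
      exact Finset.sum_eq_zero fun i _ => by
        rw [hf'0 i y fun h' => hyU (hCU h')]; simp
  have hrange : range (𝓡∂ n) = {y : EuclideanSpace ℝ (Fin n) | 0 ≤ y 0} :=
    range_modelWithCornersEuclideanHalfSpace n
  have hUi : IntegrableOn (U.indicator G) (range (𝓡∂ n)) :=
    (hGi.integrable_indicator h.measurableSet).integrableOn
  have key := setIntegral_halfSpace_divergence_eq_zero f (fun i => fderiv ℝ (f i)) hC
    (fun i => hrange ▸ hfc i) hf0 hf'0 (fun i y hy0 => ?_) (fun y hy0 => ?_) (by
      rw [← hrange]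
      exact hUi.congr (hae.mono fun y hy => hy.symm))
  · rw [← hrange, integral_congr_ae hae, setIntegral_indicator h.measurableSet,
      inter_eq_self_of_subset_right h.subset_range] at key
    exact key
  · by_cases hyU : y ∈ U
    · exact ((hderiv y hyU hy0).1 i).hasFDerivAt
    · exact ((hfev i y fun h' => hyU (hCU h')).differentiableAt_iff.2
        (differentiableAt_const 0)).hasFDerivAt
  · by_cases hyU : y ∈ U
    · simp [hf, hyU, h.flux_boundary t hyU hy0]
    · simp [hf, hyU]

end IsLocalSurface

end CapillaryHalfSpace

end

/-! ### Capillary immersions read in the charts of `M`. -/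

noncomputable section

namespace CapillaryHalfSpace

open Function Set Filter Topology

section Euclidean

variable {n : ℕ} {F : Type*} [NormedAddCommGroup F] [NormedSpace ℝ F]

theorem toMatrix_eq_of (T : EuclideanSpace ℝ (Fin n) →L[ℝ] EuclideanSpace ℝ (Fin n)) :
    LinearMap.toMatrix (EuclideanSpace.basisFun (Fin n) ℝ).toBasis
      (EuclideanSpace.basisFun (Fin n) ℝ).toBasis (T : _ →ₗ[ℝ] _) =
    Matrix.of fun j i => T (EuclideanSpace.single i 1) j := by
  ext i j
  simp [LinearMap.toMatrix_apply]

theorem det_of_eq (T : EuclideanSpace ℝ (Fin n) →L[ℝ] EuclideanSpace ℝ (Fin n)) :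
    (Matrix.of fun j i => T (EuclideanSpace.single i 1) j : Matrix (Fin n) (Fin n) ℝ).det =
      T.det := by
  rw [← toMatrix_eq_of, LinearMap.det_toMatrix]

theorem apply_eq_sum_single (L : EuclideanSpace ℝ (Fin n) →L[ℝ] F)
    (v : EuclideanSpace ℝ (Fin n)) : L v = ∑ j, v j • L (EuclideanSpace.single j 1) := by
  have h := (EuclideanSpace.basisFun (Fin n) ℝ).sum_repr v
  conv_lhs => rw [← h]
  simp

theorem inner_e (v : EuclideanSpace ℝ (Fin (n + 1))) : inner ℝ (e n) v = -v (Fin.last n) := by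
  simp [e, inner_neg_left, EuclideanSpace.inner_single_left]

theorem norm_e : ‖e n‖ = 1 := by
  simp [e]

end Euclidean

variable {n : ℕ} [NeZero n] {M : Type*} [TopologicalSpace M]
  [ChartedSpace (EuclideanHalfSpace n) M]

section Chart

variable {F : Type*} [NormedAddCommGroup F] [NormedSpace ℝ F]

/-- The differential at `p` of `f : M → F` in the preferred chart at `p`. -/
def tangentMap (f : M → F) (p : M) : EuclideanSpace ℝ (Fin n) →L[ℝ] F :=
  mfderiv (𝓡∂ n) 𝓘(ℝ, F) f p

/-- The partial derivatives at `p` of `f : M → F` in the preferred chart at `p`. -/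
def partialDeriv (f : M → F) (p : M) (i : Fin n) : F :=
  tangentMap f p (EuclideanSpace.single i 1)

/-- The derivative of the inverse of the preferred chart at `q`, the tangent spaces of `M` being
identified with `ℝⁿ` by the preferred charts. -/
def chartSymmDeriv (q : M) (y : EuclideanSpace ℝ (Fin n)) :
    EuclideanSpace ℝ (Fin n) →L[ℝ] EuclideanSpace ℝ (Fin n) :=
  mfderivWithin 𝓘(ℝ, EuclideanSpace ℝ (Fin n)) (𝓡∂ n) (extChartAt (𝓡∂ n) q).symm
    (range (𝓡∂ n)) y

/-- The matrix of `chartSymmDeriv`. -/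
def chartMatrix (q : M) (y : EuclideanSpace ℝ (Fin n)) : Matrix (Fin n) (Fin n) ℝ :=
  Matrix.of fun j i => chartSymmDeriv q y (EuclideanSpace.single i 1) j

theorem target_mem_nhdsWithin_range (q : M) :
    ∀ y ∈ (extChartAt (𝓡∂ n) q).target, (extChartAt (𝓡∂ n) q).target ∈ 𝓝[range (𝓡∂ n)] y :=
  fun _ hy => extChartAt_target_mem_nhdsWithin_of_mem hy

theorem measurableSet_target (q : M) : MeasurableSet (extChartAt (𝓡∂ n) q).target := by
  rw [extChartAt_target]
  exact (((chartAt _ q).open_target.preimage (𝓡∂ n).continuous_symm).measurableSet).inter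
    (𝓡∂ n).isClosed_range.measurableSet

theorem meanCurvature_eq {x ν : M → EuclideanSpace ℝ (Fin (n + 1))} (k : ℕ) (p : M) :
    meanCurvature x ν k p = sigma (partialDeriv x p) (partialDeriv ν p) k / (n.choose k : ℝ) := rfl

variable [IsManifold (𝓡∂ n) ∞ M]

theorem isUnit_det_chartMatrix (q : M) {y : EuclideanSpace ℝ (Fin n)}
    (hy : y ∈ (extChartAt (𝓡∂ n) q).target) : IsUnit (chartMatrix q y).det := by
  have : IsManifold (𝓡∂ n) 1 M := IsManifold.of_le (n := ∞) (by simp)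
  have h : (chartSymmDeriv q y).IsInvertible := isInvertible_mfderivWithin_extChartAt_symm hy
  obtain ⟨T, hT⟩ := h
  rw [chartMatrix, det_of_eq, ← hT]
  exact LinearEquiv.isUnit_det' T.toLinearEquiv

theorem fderivWithin_comp_symm {f : M → F} (hf : ContMDiff (𝓡∂ n) 𝓘(ℝ, F) ∞ f) (q : M)
    {y : EuclideanSpace ℝ (Fin n)} (hy : y ∈ (extChartAt (𝓡∂ n) q).target) :
    fderivWithin ℝ (f ∘ (extChartAt (𝓡∂ n) q).symm) (range (𝓡∂ n)) y =
      tangentMap f ((extChartAt (𝓡∂ n) q).symm y) ∘L chartSymmDeriv q y := by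
  have : IsManifold (𝓡∂ n) 1 M := IsManifold.of_le (n := ∞) (by simp)
  rw [← mfderivWithin_eq_fderivWithin]
  exact mfderiv_comp_mfderivWithin y ((hf _).mdifferentiableAt (by simp))
    (mdifferentiableWithinAt_extChartAt_symm hy)
    ((𝓡∂ n).uniqueDiffOn y (extChartAt_target_subset_range q hy)).uniqueMDiffWithinAt

/-- The derivative of `f` at a point is taken in the preferred chart of that point, a choice that
varies with the point. `chartMatrix` relates it to the fixed chart at `q`, which is why frame
independence of the integrands is needed. -/
theorem pderiv_comp_symm {f : M → F} (hf : ContMDiff (𝓡∂ n) 𝓘(ℝ, F) ∞ f) (q : M)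
    {y : EuclideanSpace ℝ (Fin n)} (hy : y ∈ (extChartAt (𝓡∂ n) q).target) (i : Fin n) :
    pderiv (f ∘ (extChartAt (𝓡∂ n) q).symm) y i =
      ∑ j, chartMatrix q y j i • partialDeriv f ((extChartAt (𝓡∂ n) q).symm y) j := by
  rw [pderiv, fderivWithin_comp_symm hf q hy, ContinuousLinearMap.comp_apply, apply_eq_sum_single]
  rfl

theorem contDiffOn_comp_symm {f : M → F} (hf : ContMDiff (𝓡∂ n) 𝓘(ℝ, F) ∞ f) (q : M) :
    ContDiffOn ℝ ∞ (f ∘ (extChartAt (𝓡∂ n) q).symm) (extChartAt (𝓡∂ n) q).target :=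
  (hf.comp_contMDiffOn (contMDiffOn_extChartAt_symm q)).contDiffOn

/-- Whether a point is interior may be tested in any chart of the atlas, and a point with `y 0 = 0`
is not interior to a subset of the half-space. -/
theorem symm_mem_boundary (q : M) {y : EuclideanSpace ℝ (Fin n)}
    (hy : y ∈ (extChartAt (𝓡∂ n) q).target) (hy0 : y 0 = 0) :
    (extChartAt (𝓡∂ n) q).symm y ∈ (𝓡∂ n).boundary M := by
  change (𝓡∂ n).IsBoundaryPoint _
  rw [(𝓡∂ n).isBoundaryPoint_iff_not_isInteriorPoint]
  have hsrc : (extChartAt (𝓡∂ n) q).symm y ∈ (chartAt (EuclideanHalfSpace n) q).source := by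
    rw [← extChartAt_source (𝓡∂ n)]
    exact (extChartAt (𝓡∂ n) q).map_target hy
  rw [(𝓡∂ n).isInteriorPoint_iff_of_mem_atlas (n := ∞) (by simp) (chart_mem_atlas _ q) hsrc]
  intro h
  have h1 : y ∈ interior (extChartAt (𝓡∂ n) q).target := by
    have h2 := (extChartAt (𝓡∂ n) q).right_inv hy
    rw [← h2]
    exact h
  have h2 := interior_mono (extChartAt_target_subset_range q) h1
  rw [interior_range_modelWithCornersEuclideanHalfSpace] at h2
  exact (lt_irrefl (0 : ℝ)) (hy0 ▸ h2 : (0 : ℝ) < 0)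

end Chart

section Hypersurface

variable [IsManifold (𝓡∂ n) ∞ M] {θ : ℝ} {x ν : M → EuclideanSpace ℝ (Fin (n + 1))}

theorem IsCapillaryImmersion.isLocalSurface (hx : IsCapillaryImmersion θ x ν)
    (hθ : θ ∈ Set.Ioo 0 Real.pi) (q : M) :
    IsLocalSurface (Real.cos θ) (e n) (extChartAt (𝓡∂ n) q).target
      (x ∘ (extChartAt (𝓡∂ n) q).symm) (ν ∘ (extChartAt (𝓡∂ n) q).symm) := by
  have hsub := extChartAt_target_subset_range (I := 𝓡∂ n) q
  have hX := contDiffOn_comp_symm hx.smooth q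
  have hN := contDiffOn_comp_symm hx.smooth_normal q
  have horth : ∀ y ∈ (extChartAt (𝓡∂ n) q).target, ∀ i,
      inner ℝ ((ν ∘ (extChartAt (𝓡∂ n) q).symm) y)
        (pderiv (x ∘ (extChartAt (𝓡∂ n) q).symm) y i) = 0 := by
    intro y hy i
    rw [pderiv, fderivWithin_comp_symm hx.smooth q hy]
    exact hx.normal_orthogonal _ _
  refine ⟨hsub, target_mem_nhdsWithin_range q, measurableSet_target q, hX, hN, fun y hy => ?_,
    norm_e, ?_, fun y hy hy0 => ?_, fun y hy hy0 => ?_⟩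
  · refine ⟨hx.norm_normal _, ?_, horth y hy, fun i => ?_, fun i j => ?_⟩
    · have hinj : Injective (fderivWithin ℝ (x ∘ (extChartAt (𝓡∂ n) q).symm)
          (range (𝓡∂ n)) y) := by
        have : IsManifold (𝓡∂ n) 1 M := IsManifold.of_le (n := ∞) (by simp)
        rw [fderivWithin_comp_symm hx.smooth q hy]
        exact (hx.immersion _).comp (isInvertible_mfderivWithin_extChartAt_symm hy).injective
      have hli := (EuclideanSpace.basisFun (Fin n) ℝ).toBasis.linearIndependent.map'
        (fderivWithin ℝ (x ∘ (extChartAt (𝓡∂ n) q).symm)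
          (range (𝓡∂ n)) y : EuclideanSpace ℝ (Fin n) →ₗ[ℝ] EuclideanSpace ℝ (Fin (n + 1)))
        (LinearMap.ker_eq_bot.2 hinj)
      have heq : pderiv (x ∘ (extChartAt (𝓡∂ n) q).symm) y =
          (fderivWithin ℝ (x ∘ (extChartAt (𝓡∂ n) q).symm) (range (𝓡∂ n)) y) ∘
            (EuclideanSpace.basisFun (Fin n) ℝ).toBasis := by
        ext1 i
        simp only [pderiv, comp_apply, OrthonormalBasis.coe_toBasis,
          EuclideanSpace.basisFun_apply]
      rw [heq]
      exact hli
    -- Differentiating `⟨ν, ν⟩ = 1` shows that the derivatives of `ν` are tangent.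
    · have h1 : HasFDerivWithinAt (ν ∘ (extChartAt (𝓡∂ n) q).symm) _ (range (𝓡∂ n)) y :=
        ((contDiffWithinAt_range (target_mem_nhdsWithin_range q) hN hy).differentiableWithinAt
          (by simp)).hasFDerivWithinAt
      have h2 := h1.inner ℝ h1
      have h3 : HasFDerivWithinAt (fun z => (inner ℝ ((ν ∘ (extChartAt (𝓡∂ n) q).symm) z)
          ((ν ∘ (extChartAt (𝓡∂ n) q).symm) z) : ℝ))
          (0 : EuclideanSpace ℝ (Fin n) →L[ℝ] ℝ) (range (𝓡∂ n)) y := by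
        have h4 : (fun z => (inner ℝ ((ν ∘ (extChartAt (𝓡∂ n) q).symm) z)
            ((ν ∘ (extChartAt (𝓡∂ n) q).symm) z) : ℝ)) = fun _ => 1 := by
          ext1 z
          simp [hx.norm_normal]
        rw [h4]
        exact hasFDerivWithinAt_const _ _ _
      have h5 := DFunLike.congr_fun (((𝓡∂ n).uniqueDiffOn y (hsub hy)).eq h2 h3)
        (EuclideanSpace.single i 1)
      simp only [ContinuousLinearMap.comp_apply, fderivInnerCLM_apply,
        ContinuousLinearMap.prod_apply, _root_.zero_apply] at h5
      rw [real_inner_comm _ ((ν ∘ (extChartAt (𝓡∂ n) q).symm) y)] at h5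
      rw [real_inner_comm]
      change inner ℝ (fderivWithin ℝ _ _ _ _) _ = _
      linarith
    · exact inner_pderiv_symm hsub (target_mem_nhdsWithin_range q) hX hN horth hy i j
  -- `0 < θ < π` gives `sin θ > 0`, hence `cos² θ < 1`.
  · have h1 := Real.sin_pos_of_pos_of_lt_pi hθ.1 hθ.2
    have h2 := Real.sin_sq_add_cos_sq θ
    nlinarith [sq_pos_of_pos h1]
  · rw [inner_e, comp_apply, hx.boundary_mem _ (symm_mem_boundary q hy hy0), neg_zero]
  · rw [real_inner_comm, comp_apply, hx.contact_angle _ (symm_mem_boundary q hy hy0),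
      Real.cos_pi_sub]

theorem sigma_comp_symm (hx : IsCapillaryImmersion θ x ν) (q : M)
    {y : EuclideanSpace ℝ (Fin n)} (hy : y ∈ (extChartAt (𝓡∂ n) q).target) (j : ℕ) :
    sigma (pderiv (x ∘ (extChartAt (𝓡∂ n) q).symm) y) (pderiv (ν ∘ (extChartAt (𝓡∂ n) q).symm) y) j
      = sigma (partialDeriv x ((extChartAt (𝓡∂ n) q).symm y))
        (partialDeriv ν ((extChartAt (𝓡∂ n) q).symm y)) j :=
  sigma_eq_of_eq_sum (isUnit_det_chartMatrix q hy) (pderiv_comp_symm hx.smooth q hy)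
    (pderiv_comp_symm hx.smooth_normal q hy) j

/-- The derivative of `φ` along the tangent vector field of the divergence identity. -/
def fieldDeriv (c : ℝ) (x ν : M → EuclideanSpace ℝ (Fin (n + 1))) (t : ℝ) (φ : M → ℝ) (p : M) :
    ℝ :=
  ∑ i, partialDeriv φ p i * newtonCoords (partialDeriv x p) (partialDeriv ν p) t
    (capillaryField c (e n) (x p) (ν p)) i

/-- The partial derivatives of `φ` transform as a covector and the Newton coordinates as a vector,
so their pairing is the same in both frames. -/
theorem fieldDeriv_comp_symm (hx : IsCapillaryImmersion θ x ν) (c : ℝ) (t : ℝ) {φ : M → ℝ}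
    (hφ : ContMDiff (𝓡∂ n) 𝓘(ℝ, ℝ) ∞ φ) (q : M)
    {y : EuclideanSpace ℝ (Fin n)} (hy : y ∈ (extChartAt (𝓡∂ n) q).target) :
    ∑ i, pderiv (φ ∘ (extChartAt (𝓡∂ n) q).symm) y i *
      newtonCoords (pderiv (x ∘ (extChartAt (𝓡∂ n) q).symm) y)
        (pderiv (ν ∘ (extChartAt (𝓡∂ n) q).symm) y) t
        (capillaryField c (e n) ((x ∘ (extChartAt (𝓡∂ n) q).symm) y)
          ((ν ∘ (extChartAt (𝓡∂ n) q).symm) y)) i =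
      fieldDeriv c x ν t φ ((extChartAt (𝓡∂ n) q).symm y) := by
  rw [fieldDeriv, ← newtonCoords_eq_of_eq_sum (isUnit_det_chartMatrix q hy)
    (pderiv_comp_symm hx.smooth q hy) (pderiv_comp_symm hx.smooth_normal q hy)]
  simp only [pderiv_comp_symm hφ q hy, Matrix.mulVec, dotProduct, Finset.sum_mul, Finset.mul_sum,
    smul_eq_mul, comp_apply]
  rw [Finset.sum_comm]
  refine Finset.sum_congr rfl fun i _ => Finset.sum_congr rfl fun j _ => ?_
  ring

end Hypersurface

end CapillaryHalfSpace

end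

/-! ### The area measure and integration in charts. -/

noncomputable section

namespace CapillaryHalfSpace

open Function Set Filter Topology

variable {n : ℕ} [NeZero n] {M : Type*} [TopologicalSpace M]
  [ChartedSpace (EuclideanHalfSpace n) M]

/-- The area density in the preferred chart at `q`. -/
def chartDensity (x : M → EuclideanSpace ℝ (Fin (n + 1))) (q : M)
    (y : EuclideanSpace ℝ (Fin n)) : ℝ :=
  Real.sqrt (chartMetric x q y).det

theorem chartMetric_eq_gram (x : M → EuclideanSpace ℝ (Fin (n + 1))) (q : M)
    (y : EuclideanSpace ℝ (Fin n)) :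
    chartMetric x q y = Matrix.gram ℝ (pderiv (x ∘ (extChartAt (𝓡∂ n) q).symm) y) := rfl

theorem continuousOn_chartDensity [IsManifold (𝓡∂ n) ∞ M] {x : M → EuclideanSpace ℝ (Fin (n + 1))}
    (hx : ContMDiff (𝓡∂ n) 𝓘(ℝ, EuclideanSpace ℝ (Fin (n + 1))) ∞ x) (q : M) :
    ContinuousOn (chartDensity x q) (extChartAt (𝓡∂ n) q).target := by
  have hG : ContinuousOn (fun y => chartMetric x q y) (extChartAt (𝓡∂ n) q).target :=
    continuousOn_gram (continuousOn_pderiv (extChartAt_target_subset_range q)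
      (target_mem_nhdsWithin_range q) (contDiffOn_comp_symm hx q))
  exact Real.continuous_sqrt.comp_continuousOn
    ((continuous_id.matrix_det).comp_continuousOn hG)

theorem aemeasurable_toNNReal_chartDensity [IsManifold (𝓡∂ n) ∞ M]
    {x : M → EuclideanSpace ℝ (Fin (n + 1))} {q : M}
    (hx : ContMDiff (𝓡∂ n) 𝓘(ℝ, EuclideanSpace ℝ (Fin (n + 1))) ∞ x) :
    AEMeasurable (fun y => (chartDensity x q y).toNNReal)
      ((volume : Measure (EuclideanSpace ℝ (Fin n))).restrict (extChartAt (𝓡∂ n) q).target) :=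
  ((continuousOn_chartDensity hx q).aemeasurable (measurableSet_target q)).real_toNNReal

variable [MeasurableSpace M] [BorelSpace M]

theorem measurableSet_source (q : M) :
    MeasurableSet (extChartAt (𝓡∂ n) q).source :=
  (isOpen_extChartAt_source q).measurableSet

theorem measurableSet_target_inter_preimage (q : M) {A : Set M} (hA : MeasurableSet A) :
    MeasurableSet ((extChartAt (𝓡∂ n) q).target ∩ (extChartAt (𝓡∂ n) q).symm ⁻¹' A) := by
  have h := continuousOn_iff_continuous_domRestrict.1 (continuousOn_extChartAt_symm (I := 𝓡∂ n) q)
  have h1 := (measurableSet_target q).subtype_image (h.measurable hA)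
  convert h1 using 1
  ext y
  exact ⟨fun hy => ⟨⟨y, hy.1⟩, hy.2, rfl⟩, fun ⟨z, hz, hzy⟩ => hzy ▸ ⟨z.2, hz⟩⟩

theorem aemeasurable_symm (q : M) :
    AEMeasurable (extChartAt (𝓡∂ n) q).symm
      ((volume : Measure (EuclideanSpace ℝ (Fin n))).restrict (extChartAt (𝓡∂ n) q).target) :=
  (continuousOn_extChartAt_symm q).aemeasurable (measurableSet_target q)

theorem aemeasurable_symm_withDensity (x : M → EuclideanSpace ℝ (Fin (n + 1))) (q : M) :
    AEMeasurable (extChartAt (𝓡∂ n) q).symm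
      (((volume : Measure (EuclideanSpace ℝ (Fin n))).restrict
        (extChartAt (𝓡∂ n) q).target).withDensity
        fun y => ENNReal.ofReal (Real.sqrt (chartMetric x q y).det)) :=
  (aemeasurable_symm q).mono_ac (withDensity_absolutelyContinuous _ _)

theorem chartArea_apply (x : M → EuclideanSpace ℝ (Fin (n + 1))) (q : M) {A : Set M}
    (hA : MeasurableSet A) :
    chartArea x q A = ∫⁻ y in (extChartAt (𝓡∂ n) q).target ∩ (extChartAt (𝓡∂ n) q).symm ⁻¹' A,
      ENNReal.ofReal (chartDensity x q y) := by
  rw [chartArea, Measure.map_apply_of_aemeasurable (aemeasurable_symm_withDensity x q) hA,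
    withDensity_apply', Measure.restrict_restrict' (measurableSet_target q), inter_comm]
  rfl

theorem chartArea_compl_source (x : M → EuclideanSpace ℝ (Fin (n + 1))) (q : M) :
    chartArea x q (extChartAt (𝓡∂ n) q).sourceᶜ = 0 := by
  rw [chartArea_apply x q (measurableSet_source q).compl]
  have : (extChartAt (𝓡∂ n) q).target ∩
      (extChartAt (𝓡∂ n) q).symm ⁻¹' (extChartAt (𝓡∂ n) q).sourceᶜ = ∅ := by
    ext y
    simp only [mem_inter_iff, mem_preimage, mem_compl_iff, mem_empty_iff_false, iff_false, not_and,
      not_not]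
    exact fun hy => (extChartAt (𝓡∂ n) q).map_target hy
  rw [this]
  simp

theorem aestronglyMeasurable_chartArea {x : M → EuclideanSpace ℝ (Fin (n + 1))} {q : M}
    {f : M → ℝ}
    (hf : ContinuousOn (f ∘ (extChartAt (𝓡∂ n) q).symm) (extChartAt (𝓡∂ n) q).target) :
    AEStronglyMeasurable f (chartArea x q) := by
  have h1 : ContinuousOn f (extChartAt (𝓡∂ n) q).source := by
    refine (hf.comp (continuousOn_extChartAt q)
      (extChartAt (𝓡∂ n) q).mapsTo).congr fun p hp => ?_
    simp only [comp_apply, (extChartAt (𝓡∂ n) q).left_inv hp]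
  have h2 : (chartArea x q).restrict (extChartAt (𝓡∂ n) q).source = chartArea x q :=
    Measure.restrict_eq_self_of_ae_mem (by
      rw [ae_iff]
      exact chartArea_compl_source x q)
  rw [← h2]
  exact h1.aestronglyMeasurable (measurableSet_source q)

variable [IsManifold (𝓡∂ n) ∞ M]

/-- Change of variables along the transition map `τ`: the density picks up the factor `|det Dτ|`.
Only an inequality holds, because the chart at `p` need not cover `A`. -/
theorem chartArea_le_of_subset_source {x : M → EuclideanSpace ℝ (Fin (n + 1))}
    (hx : ContMDiff (𝓡∂ n) 𝓘(ℝ, EuclideanSpace ℝ (Fin (n + 1))) ∞ x) (p q : M) {A : Set M}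
    (hA : MeasurableSet A) (hAq : A ⊆ (extChartAt (𝓡∂ n) q).source) :
    chartArea x p A ≤ chartArea x q A := by
  rw [chartArea_apply x p hA, chartArea_apply x q hA]
  set φ := extChartAt (𝓡∂ n) p with hφ
  set χ := extChartAt (𝓡∂ n) q with hχ
  set S := φ.target ∩ φ.symm ⁻¹' A with hS
  set τ : EuclideanSpace ℝ (Fin n) → EuclideanSpace ℝ (Fin n) := χ ∘ φ.symm with hτ
  have hSm : MeasurableSet S := measurableSet_target_inter_preimage p hA
  have hτd : ∀ y ∈ S, HasFDerivWithinAt τ (fderivWithin ℝ τ (range (𝓡∂ n)) y)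
      (range (𝓡∂ n)) y := by
    intro y hy
    have h1 : ContDiffWithinAt ℝ ∞ τ (range (𝓡∂ n)) y := by
      refine contDiffWithinAt_ext_coord_change q p ?_
      rw [PartialEquiv.trans_source, PartialEquiv.symm_source]
      exact ⟨hy.1, hAq hy.2⟩
    exact (h1.differentiableWithinAt (by simp)).hasFDerivWithinAt
  have hτS : ∀ y ∈ S, HasFDerivWithinAt τ (fderivWithin ℝ τ (range (𝓡∂ n)) y) S y := fun y hy =>
    (hτd y hy).mono (inter_subset_left.trans (extChartAt_target_subset_range p))
  have hinj : InjOn τ S := by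
    intro a ha b hb hab
    have h1 := χ.injOn (hAq ha.2) (hAq hb.2) hab
    exact φ.symm.injOn ha.1 hb.1 h1
  have hsub : τ '' S ⊆ χ.target ∩ χ.symm ⁻¹' A := by
    rintro _ ⟨y, hy, rfl⟩
    refine ⟨χ.map_source (hAq hy.2), ?_⟩
    rw [mem_preimage, hτ, comp_apply, χ.left_inv (hAq hy.2)]
    exact hy.2
  have hdens : ∀ y ∈ S, chartDensity x p y =
      |(fderivWithin ℝ τ (range (𝓡∂ n)) y).det| * chartDensity x q (τ y) := by
    intro y hy
    have hτy : τ y ∈ χ.target := χ.map_source (hAq hy.2)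
    have hev : φ.symm ⁻¹' χ.source ∩ φ.target ∈ 𝓝[range (𝓡∂ n)] y := by
      refine inter_mem ?_ (target_mem_nhdsWithin_range p y hy.1)
      exact (((continuousOn_extChartAt_symm (I := 𝓡∂ n) p) y hy.1).mono_of_mem_nhdsWithin
        (target_mem_nhdsWithin_range p y hy.1))
        ((isOpen_extChartAt_source q).mem_nhds (hAq hy.2))
    have hXq : HasFDerivWithinAt (x ∘ χ.symm)
        (fderivWithin ℝ (x ∘ χ.symm) (range (𝓡∂ n)) (τ y)) (range (𝓡∂ n)) (τ y) :=
      ((contDiffWithinAt_range (target_mem_nhdsWithin_range q) (contDiffOn_comp_symm hx q)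
        hτy).differentiableWithinAt (by simp)).hasFDerivWithinAt
    have hcomp : HasFDerivWithinAt (x ∘ φ.symm)
        (fderivWithin ℝ (x ∘ χ.symm) (range (𝓡∂ n)) (τ y) ∘L
          fderivWithin ℝ τ (range (𝓡∂ n)) y) (range (𝓡∂ n)) y := by
      have h1 := hXq.comp y ((hτd y hy).mono
        ((inter_subset_right (s := φ.symm ⁻¹' χ.source)).trans (extChartAt_target_subset_range p)))
        (fun z hz => extChartAt_target_subset_range q (χ.map_source hz.1))
      have h2 : HasFDerivWithinAt (x ∘ φ.symm)
          (fderivWithin ℝ (x ∘ χ.symm) (range (𝓡∂ n)) (τ y) ∘L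
          fderivWithin ℝ τ (range (𝓡∂ n)) y) (φ.symm ⁻¹' χ.source ∩ φ.target) y := by
        refine h1.congr (fun z hz => ?_) ?_
        · simp only [hτ, comp_apply, χ.left_inv hz.1]
        · simp only [hτ, comp_apply, χ.left_inv (hAq hy.2)]
      exact h2.mono_of_mem_nhdsWithin hev
    have hfd := hcomp.fderivWithin ((𝓡∂ n).uniqueDiffOn y (extChartAt_target_subset_range p hy.1))
    have hsum : ∀ i, pderiv (x ∘ φ.symm) y i =
        ∑ j, (Matrix.of fun j i => fderivWithin ℝ τ (range (𝓡∂ n)) y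
          (EuclideanSpace.single i 1) j : Matrix (Fin n) (Fin n) ℝ) j i •
          pderiv (x ∘ χ.symm) (τ y) j := by
      intro i
      rw [pderiv, hfd, ContinuousLinearMap.comp_apply, apply_eq_sum_single]
      rfl
    rw [chartDensity, chartDensity, chartMetric_eq_gram, chartMetric_eq_gram,
      gram_eq_of_eq_sum hsum, Matrix.det_mul, Matrix.det_mul, Matrix.det_transpose, det_of_eq,
      mul_right_comm, Real.sqrt_mul (mul_self_nonneg _), Real.sqrt_mul_self_eq_abs]
  calc ∫⁻ y in S, ENNReal.ofReal (chartDensity x p y)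
      = ∫⁻ y in S, ENNReal.ofReal |(fderivWithin ℝ τ (range (𝓡∂ n)) y).det| *
          ENNReal.ofReal (chartDensity x q (τ y)) := by
        refine setLIntegral_congr_fun hSm fun y hy => ?_
        rw [← ENNReal.ofReal_mul (abs_nonneg _), ← hdens y hy]
    _ = ∫⁻ y in τ '' S, ENNReal.ofReal (chartDensity x q y) :=
        (lintegral_image_eq_lintegral_abs_det_fderiv_mul volume hSm hτS hinj
          (fun y => ENNReal.ofReal (chartDensity x q y))).symm
    _ ≤ _ := lintegral_mono_set hsub

/-- The supremum is controlled by bounding every `chartArea x p` by one fixed measure: on the source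
of the chart at `q` it is at most `chartArea x q`, and off that source at most `areaMeasure x`.
Restriction to the source removes the second part. -/
theorem areaMeasure_restrict_source {x : M → EuclideanSpace ℝ (Fin (n + 1))}
    (hx : ContMDiff (𝓡∂ n) 𝓘(ℝ, EuclideanSpace ℝ (Fin (n + 1))) ∞ x) (q : M) :
    (areaMeasure x).restrict (extChartAt (𝓡∂ n) q).source = chartArea x q := by
  have hs := measurableSet_source (n := n) q
  have hq : (chartArea x q).restrict (extChartAt (𝓡∂ n) q).source = chartArea x q :=
    Measure.restrict_eq_self_of_ae_mem (by
      rw [ae_iff]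
      exact chartArea_compl_source x q)
  refine le_antisymm ?_ ?_
  · have hle : areaMeasure x ≤
        chartArea x q + (areaMeasure x).restrict (extChartAt (𝓡∂ n) q).sourceᶜ := by
      refine iSup_le fun p => ?_
      rw [← Measure.restrict_add_restrict_compl (μ := chartArea x p) hs]
      refine add_le_add ?_ (Measure.restrict_mono_measure (le_iSup (chartArea x) p) _)
      rw [Measure.le_iff]
      intro A hA
      rw [Measure.restrict_apply hA]
      exact (chartArea_le_of_subset_source hx p q (hA.inter hs) inter_subset_right).trans
        (measure_mono inter_subset_left)
    have h1 := Measure.restrict_mono_measure hle (extChartAt (𝓡∂ n) q).source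
    rw [Measure.restrict_add, hq, Measure.restrict_restrict hs] at h1
    simpa using h1
  · rw [← hq]
    exact Measure.restrict_mono_measure (le_iSup (chartArea x) q) _

section Integral

variable {x : M → EuclideanSpace ℝ (Fin (n + 1))} {q : M} {f : M → ℝ}

/-- Integrals over `M` of functions supported in a chart domain, in coordinates. -/
theorem integral_areaMeasure_eq
    (hx : ContMDiff (𝓡∂ n) 𝓘(ℝ, EuclideanSpace ℝ (Fin (n + 1))) ∞ x)
    (hf0 : ∀ p ∉ (extChartAt (𝓡∂ n) q).source, f p = 0)
    (hf : ContinuousOn (f ∘ (extChartAt (𝓡∂ n) q).symm) (extChartAt (𝓡∂ n) q).target) :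
    ∫ p, f p ∂(areaMeasure x) = ∫ y in (extChartAt (𝓡∂ n) q).target,
      chartDensity x q y * f ((extChartAt (𝓡∂ n) q).symm y) := by
  rw [← setIntegral_eq_integral_of_forall_compl_eq_zero hf0, areaMeasure_restrict_source hx q]
  have hm := aestronglyMeasurable_chartArea (x := x) hf
  rw [chartArea] at hm ⊢
  rw [integral_map (aemeasurable_symm_withDensity x q) hm]
  refine (integral_withDensity_eq_integral_smul₀ (aemeasurable_toNNReal_chartDensity hx) _).trans ?_
  refine integral_congr_ae (Eventually.of_forall fun y => ?_)
  simp only [NNReal.smul_def, smul_eq_mul]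
  rw [Real.coe_toNNReal _ (show 0 ≤ chartDensity x q y from Real.sqrt_nonneg _)]

theorem integrable_areaMeasure_iff
    (hx : ContMDiff (𝓡∂ n) 𝓘(ℝ, EuclideanSpace ℝ (Fin (n + 1))) ∞ x)
    (hf0 : ∀ p ∉ (extChartAt (𝓡∂ n) q).source, f p = 0)
    (hf : ContinuousOn (f ∘ (extChartAt (𝓡∂ n) q).symm) (extChartAt (𝓡∂ n) q).target) :
    Integrable f (areaMeasure x) ↔ IntegrableOn (fun y =>
      chartDensity x q y * f ((extChartAt (𝓡∂ n) q).symm y)) (extChartAt (𝓡∂ n) q).target := by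
  have h1 : Integrable f (areaMeasure x) ↔
      IntegrableOn f (extChartAt (𝓡∂ n) q).source (areaMeasure x) :=
    (integrableOn_iff_integrable_of_support_subset fun p hp => by
      by_contra h
      exact hp (hf0 p h)).symm
  have hm := aestronglyMeasurable_chartArea (x := x) hf
  rw [h1, IntegrableOn, areaMeasure_restrict_source hx q]
  rw [chartArea] at hm ⊢
  rw [integrable_map_measure hm (aemeasurable_symm_withDensity x q)]
  refine (integrable_withDensity_iff_integrable_smul₀
    (aemeasurable_toNNReal_chartDensity hx)).trans ?_
  refine integrable_congr (Eventually.of_forall fun y => ?_)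
  simp only [NNReal.smul_def, smul_eq_mul]
  rw [Real.coe_toNNReal _ (show 0 ≤ chartDensity x q y from Real.sqrt_nonneg _), comp_apply]

end Integral

end CapillaryHalfSpace

end

/-! ### Partition of unity and the global integral identities. -/

noncomputable section

namespace CapillaryHalfSpace

open Function Set Filter Topology

variable {n : ℕ} [NeZero n] {M : Type*} [TopologicalSpace M]
  [ChartedSpace (EuclideanHalfSpace n) M]

theorem partialDeriv_eq_zero_of_notMem_tsupport {φ : M → ℝ} {p : M} (hp : p ∉ tsupport φ)
    (i : Fin n) : partialDeriv φ p i = 0 := by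
  have h : φ =ᶠ[𝓝 p] fun _ => 0 := notMem_tsupport_iff_eventuallyEq.1 hp
  have h1 : tangentMap φ p = (0 : EuclideanSpace ℝ (Fin n) →L[ℝ] ℝ) := by
    rw [tangentMap, h.mfderiv_eq]
    exact mfderiv_const
  rw [partialDeriv, h1]
  rfl

theorem sum_partialDeriv_eq_zero {ι : Type*} [Fintype ι] {φ : ι → M → ℝ}
    (hφ : ∀ i, ContMDiff (𝓡∂ n) 𝓘(ℝ, ℝ) ∞ (φ i)) (hsum : ∀ p, ∑ i, φ i p = 1) (p : M)
    (j : Fin n) : ∑ i, partialDeriv (φ i) p j = 0 := by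
  have hd : ∀ i, MDifferentiableAt (𝓡∂ n) 𝓘(ℝ, ℝ) (φ i) p := fun i =>
    (hφ i p).mdifferentiableAt (by simp)
  have h1 : ∀ i, tangentMap (φ i) p = fderivWithin ℝ (φ i ∘ (extChartAt (𝓡∂ n) p).symm)
      (range (𝓡∂ n)) (extChartAt (𝓡∂ n) p p) := fun i => (hd i).mfderiv
  have h2 : ∀ i, DifferentiableWithinAt ℝ (φ i ∘ (extChartAt (𝓡∂ n) p).symm)
      (range (𝓡∂ n)) (extChartAt (𝓡∂ n) p p) := fun i =>
    (hd i).differentiableWithinAt_writtenInExtChartAt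
  have huniq : UniqueDiffWithinAt ℝ (range (𝓡∂ n)) (extChartAt (𝓡∂ n) p p) :=
    (𝓡∂ n).uniqueDiffOn _ (extChartAt_target_subset_range p (mem_extChartAt_target p))
  have h3 := fderivWithin_fun_sum (𝕜 := ℝ) (u := Finset.univ) huniq fun i _ => h2 i
  have h4 : (fun y => ∑ i, (φ i ∘ (extChartAt (𝓡∂ n) p).symm) y) = fun _ => 1 := by
    ext1 y
    exact hsum _
  rw [h4] at h3
  simp only [partialDeriv, h1, ← _root_.sum_apply, ← h3]
  simp

variable {θ : ℝ} {x ν : M → EuclideanSpace ℝ (Fin (n + 1))} {φ : M → ℝ} {q : M}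

theorem isCompact_image_tsupport [CompactSpace M] (hφ : tsupport φ ⊆ (extChartAt (𝓡∂ n) q).source) :
    IsCompact (extChartAt (𝓡∂ n) q '' tsupport φ) :=
  (isClosed_tsupport φ).isCompact.image_of_continuousOn ((continuousOn_extChartAt q).mono hφ)

theorem symm_notMem_tsupport {y : EuclideanSpace ℝ (Fin n)}
    (hy : y ∈ (extChartAt (𝓡∂ n) q).target) (hyC : y ∉ extChartAt (𝓡∂ n) q '' tsupport φ) :
    (extChartAt (𝓡∂ n) q).symm y ∉ tsupport φ := fun h =>
  hyC ⟨_, h, (extChartAt (𝓡∂ n) q).right_inv hy⟩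

variable [IsManifold (𝓡∂ n) ∞ M]

theorem continuousOn_sigma_comp_symm (hx : IsCapillaryImmersion θ x ν)
    (hθ : θ ∈ Set.Ioo 0 Real.pi) (q : M) {j : ℕ} (hj : j ≤ n) :
    ContinuousOn ((fun p => sigma (partialDeriv x p) (partialDeriv ν p) j) ∘
      (extChartAt (𝓡∂ n) q).symm) (extChartAt (𝓡∂ n) q).target := by
  have h := hx.isLocalSurface hθ q
  exact (continuousOn_sigma h.frame h.continuousOn_tangent h.continuousOn_deriv_normal hj).congr
    fun y hy => (sigma_comp_symm hx q hy j).symm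

variable (n M) in
theorem exists_finite_partition [CompactSpace M] [T2Space M] : ∃ (s : Finset M) (φ : s → M → ℝ),
    (∀ i, ContMDiff (𝓡∂ n) 𝓘(ℝ, ℝ) ∞ (φ i)) ∧
    (∀ i, tsupport (φ i) ⊆ (extChartAt (𝓡∂ n) (i : M)).source) ∧ ∀ p, ∑ i, φ i p = 1 := by
  obtain ⟨s, hs⟩ := isCompact_univ.elim_finite_subcover
    (fun q : M => (extChartAt (𝓡∂ n) q).source) (fun q => isOpen_extChartAt_source q)
    fun p _ => mem_iUnion.2 ⟨p, mem_extChartAt_source p⟩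
  obtain ⟨ρ, hρ⟩ := SmoothPartitionOfUnity.exists_isSubordinate (𝓡∂ n) (s := (univ : Set M))
    isClosed_univ (fun i : s => (extChartAt (𝓡∂ n) (i : M)).source)
    (fun i => isOpen_extChartAt_source (i : M)) (by
      intro p hp
      obtain ⟨i, hi, hpi⟩ := mem_iUnion₂.1 (hs hp)
      exact mem_iUnion.2 ⟨⟨i, hi⟩, hpi⟩)
  refine ⟨s, fun i => ρ i, fun i => (ρ i).contMDiff, hρ, fun p => ?_⟩
  rw [← finsum_eq_sum_of_fintype]
  exact ρ.sum_eq_one (mem_univ p)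

variable [CompactSpace M] [MeasurableSpace M] [BorelSpace M]

theorem integrable_of_continuousOn_comp_symm
    (hx : ContMDiff (𝓡∂ n) 𝓘(ℝ, EuclideanSpace ℝ (Fin (n + 1))) ∞ x)
    (hφ : tsupport φ ⊆ (extChartAt (𝓡∂ n) q).source) {f : M → ℝ}
    (hf0 : ∀ p ∉ tsupport φ, f p = 0)
    (hf : ContinuousOn (f ∘ (extChartAt (𝓡∂ n) q).symm) (extChartAt (𝓡∂ n) q).target) :
    Integrable f (areaMeasure x) := by
  rw [integrable_areaMeasure_iff hx (fun p hp => hf0 p fun h => hp (hφ h)) hf]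
  refine integrableOn_of_continuousOn_of_eq_zero (measurableSet_target q)
    ((continuousOn_chartDensity hx q).mul hf) (isCompact_image_tsupport hφ) ?_ fun y hy hyC => ?_
  · rintro _ ⟨p, hp, rfl⟩
    exact (extChartAt (𝓡∂ n) q).map_source (hφ hp)
  · rw [hf0 _ (symm_notMem_tsupport hy hyC), mul_zero]

/-- For `φ` supported in one chart domain, this is the divergence identity of that chart,
transported by frame independence and the formula for the area density. -/
theorem integral_add_fieldDeriv_eq_zero (hx : IsCapillaryImmersion θ x ν)
    (hθ : θ ∈ Set.Ioo 0 Real.pi) (hφs : ContMDiff (𝓡∂ n) 𝓘(ℝ, ℝ) ∞ φ)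
    (hφ : tsupport φ ⊆ (extChartAt (𝓡∂ n) q).source) (t : ℝ) :
    Integrable (fun p => φ p * minkowskiIntegrand (Real.cos θ) (e n) (x p) (ν p)
      (partialDeriv x p) (partialDeriv ν p) t + fieldDeriv (Real.cos θ) x ν t φ p)
      (areaMeasure x) ∧
    ∫ p, (φ p * minkowskiIntegrand (Real.cos θ) (e n) (x p) (ν p)
      (partialDeriv x p) (partialDeriv ν p) t + fieldDeriv (Real.cos θ) x ν t φ p)
      ∂(areaMeasure x) = 0 := by
  set f : M → ℝ := fun p => φ p * minkowskiIntegrand (Real.cos θ) (e n) (x p) (ν p)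
      (partialDeriv x p) (partialDeriv ν p) t + fieldDeriv (Real.cos θ) x ν t φ p with hf
  have h := hx.isLocalSurface hθ q
  have hψ := contDiffOn_comp_symm hφs q
  have hf0 : ∀ p ∉ tsupport φ, f p = 0 := by
    intro p hp
    simp [hf, fieldDeriv, partialDeriv_eq_zero_of_notMem_tsupport hp,
      image_eq_zero_of_notMem_tsupport hp]
  have hfs : ∀ y ∈ (extChartAt (𝓡∂ n) q).target, f ((extChartAt (𝓡∂ n) q).symm y) =
      (φ ∘ (extChartAt (𝓡∂ n) q).symm) y * minkowskiIntegrand (Real.cos θ) (e n)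
        ((x ∘ (extChartAt (𝓡∂ n) q).symm) y) ((ν ∘ (extChartAt (𝓡∂ n) q).symm) y)
        (pderiv (x ∘ (extChartAt (𝓡∂ n) q).symm) y)
        (pderiv (ν ∘ (extChartAt (𝓡∂ n) q).symm) y) t +
      ∑ i, pderiv (φ ∘ (extChartAt (𝓡∂ n) q).symm) y i *
        newtonCoords (pderiv (x ∘ (extChartAt (𝓡∂ n) q).symm) y)
        (pderiv (ν ∘ (extChartAt (𝓡∂ n) q).symm) y) t
        (capillaryField (Real.cos θ) (e n) ((x ∘ (extChartAt (𝓡∂ n) q).symm) y)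
          ((ν ∘ (extChartAt (𝓡∂ n) q).symm) y)) i := by
    intro y hy
    rw [fieldDeriv_comp_symm hx _ t hφs q hy, minkowskiIntegrand_eq_of_eq_sum
      (isUnit_det_chartMatrix q hy) (pderiv_comp_symm hx.smooth q hy)
      (pderiv_comp_symm hx.smooth_normal q hy)]
    rfl
  have hfc : ContinuousOn (f ∘ (extChartAt (𝓡∂ n) q).symm) (extChartAt (𝓡∂ n) q).target := by
    refine ContinuousOn.congr ?_ hfs
    refine (hψ.continuousOn.mul (h.continuousOn_minkowskiIntegrand t)).add
      (continuousOn_finsetSum _ fun i _ => ?_)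
    exact (continuousOn_pderiv h.subset_range h.mem_nhdsWithin hψ i).mul
      (continuousOn_newtonCoords h.frame h.smooth_normal.continuousOn h.continuousOn_tangent
        h.continuousOn_deriv_normal h.continuousOn_capillaryField t i)
  refine ⟨integrable_of_continuousOn_comp_symm hx.smooth hφ hf0 hfc, ?_⟩
  rw [integral_areaMeasure_eq hx.smooth (fun p hp => hf0 p fun h => hp (hφ h)) hfc,
    ← h.setIntegral_divergence_eq_zero t hψ (isCompact_image_tsupport hφ) ?_ ?_]
  · refine setIntegral_congr_fun (measurableSet_target q) fun y hy => ?_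
    simp only [hfs y hy]
    rw [chartDensity, chartMetric_eq_gram, (h.frame y hy).sqrt_det_gram]
  · rintro _ ⟨p, hp, rfl⟩
    exact (extChartAt (𝓡∂ n) q).map_source (hφ hp)
  · intro y hy hyC
    exact image_eq_zero_of_notMem_tsupport (f := φ) (symm_notMem_tsupport hy hyC)

/-- Each product with a partition function vanishes off a compact subset of one chart domain, so
continuity in every fixed chart suffices. -/
theorem integrable_of_forall_continuousOn_comp_symm [T2Space M]
    (hx : ContMDiff (𝓡∂ n) 𝓘(ℝ, EuclideanSpace ℝ (Fin (n + 1))) ∞ x) {f : M → ℝ}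
    (hf : ∀ q, ContinuousOn (f ∘ (extChartAt (𝓡∂ n) q).symm) (extChartAt (𝓡∂ n) q).target) :
    Integrable f (areaMeasure x) := by
  obtain ⟨s, φ, hφs, hφ, hsum⟩ := exists_finite_partition n M
  have h1 : f = fun p => ∑ i, φ i p * f p := by
    ext1 p
    rw [← Finset.sum_mul, hsum, one_mul]
  rw [h1]
  refine integrable_finsetSum _ fun i _ => ?_
  refine integrable_of_continuousOn_comp_symm hx (hφ i) (fun p hp => ?_) ?_
  · rw [image_eq_zero_of_notMem_tsupport hp, zero_mul]
  · exact (contDiffOn_comp_symm (hφs i) i).continuousOn.mul (hf i)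

/-- Summing the localized identities over the partition, the terms `fieldDeriv` cancel: they are
linear in the derivatives of the `φ i`, which add up to the derivative of the constant `1`. -/
theorem integral_minkowskiIntegrand_eq_zero [T2Space M] (hx : IsCapillaryImmersion θ x ν)
    (hθ : θ ∈ Set.Ioo 0 Real.pi) (t : ℝ) :
    ∫ p, minkowskiIntegrand (Real.cos θ) (e n) (x p) (ν p)
      (partialDeriv x p) (partialDeriv ν p) t ∂(areaMeasure x) = 0 := by
  obtain ⟨s, φ, hφs, hφ, hsum⟩ := exists_finite_partition n M
  have h1 : (fun p => minkowskiIntegrand (Real.cos θ) (e n) (x p) (ν p)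
      (partialDeriv x p) (partialDeriv ν p) t) = fun p => ∑ i,
      (φ i p * minkowskiIntegrand (Real.cos θ) (e n) (x p) (ν p)
        (partialDeriv x p) (partialDeriv ν p) t + fieldDeriv (Real.cos θ) x ν t (φ i) p) := by
    ext1 p
    have h2 : ∑ i, fieldDeriv (Real.cos θ) x ν t (φ i) p = 0 := by
      simp only [fieldDeriv]
      rw [Finset.sum_comm]
      refine Finset.sum_eq_zero fun j _ => ?_
      rw [← Finset.sum_mul, sum_partialDeriv_eq_zero hφs hsum, zero_mul]
    rw [Finset.sum_add_distrib, h2, ← Finset.sum_mul, hsum, one_mul, add_zero]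
  rw [h1, integral_finsetSum _ fun i _ =>
    (integral_add_fieldDeriv_eq_zero hx hθ (hφs i) (hφ i) t).1]
  exact Finset.sum_eq_zero fun i _ => (integral_add_fieldDeriv_eq_zero hx hθ (hφs i) (hφ i) t).2

theorem integrable_sigma_mul_angle [T2Space M] (hx : IsCapillaryImmersion θ x ν)
    (hθ : θ ∈ Set.Ioo 0 Real.pi) {j : ℕ} (hj : j ≤ n) :
    Integrable (fun p => sigma (partialDeriv x p) (partialDeriv ν p) j *
      (1 + Real.cos θ * inner ℝ (ν p) (e n))) (areaMeasure x) := by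
  refine integrable_of_forall_continuousOn_comp_symm hx.smooth fun q => ?_
  have hN := (contDiffOn_comp_symm hx.smooth_normal q).continuousOn
  exact (continuousOn_sigma_comp_symm hx hθ q hj).mul (continuousOn_const.add
    (continuousOn_const.mul (hN.inner (𝕜 := ℝ) continuousOn_const)))

theorem integrable_sigma_mul_support [T2Space M] (hx : IsCapillaryImmersion θ x ν)
    (hθ : θ ∈ Set.Ioo 0 Real.pi) {j : ℕ} (hj : j ≤ n) :
    Integrable (fun p => sigma (partialDeriv x p) (partialDeriv ν p) j *
      inner ℝ (x p) (ν p)) (areaMeasure x) := by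
  refine integrable_of_forall_continuousOn_comp_symm hx.smooth fun q => ?_
  exact (continuousOn_sigma_comp_symm hx hθ q hj).mul
    ((contDiffOn_comp_symm hx.smooth q).continuousOn.inner (𝕜 := ℝ)
      (contDiffOn_comp_symm hx.smooth_normal q).continuousOn)

theorem integral_sigma_identity [T2Space M] (hx : IsCapillaryImmersion θ x ν)
    (hθ : θ ∈ Set.Ioo 0 Real.pi) {j : ℕ} (hj : j < n) :
    ((n : ℝ) - j) * ∫ p, sigma (partialDeriv x p) (partialDeriv ν p) j *
      (1 + Real.cos θ * inner ℝ (ν p) (e n)) ∂(areaMeasure x) =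
    ((j : ℝ) + 1) * ∫ p, sigma (partialDeriv x p) (partialDeriv ν p) (j + 1) *
      inner ℝ (x p) (ν p) ∂(areaMeasure x) := by
  set a : ℕ → M → ℝ := fun j p => sigma (partialDeriv x p) (partialDeriv ν p) j *
      (1 + Real.cos θ * inner ℝ (ν p) (e n)) with ha
  set b : ℕ → M → ℝ := fun j p => sigma (partialDeriv x p) (partialDeriv ν p) j *
      inner ℝ (x p) (ν p) with hb
  set A : ℕ → ℝ := fun j => ((n : ℝ) - j) * ∫ p, a j p ∂(areaMeasure x) -
    ((j : ℝ) + 1) * ∫ p, b (j + 1) p ∂(areaMeasure x) with hA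
  have hai : ∀ j < n, Integrable (a j) (areaMeasure x) := fun j hj =>
    integrable_sigma_mul_angle hx hθ hj.le
  have hbi : ∀ j < n, Integrable (b (j + 1)) (areaMeasure x) := fun j hj =>
    integrable_sigma_mul_support hx hθ hj
  -- The integrated generating function is a polynomial in `t` with coefficients `A j`; vanishing
  -- for all real `t` makes every coefficient zero.
  have hint : ∀ t : ℝ, ∑ j ∈ Finset.range n, A j * t ^ j = 0 := by
    intro t
    rw [← integral_minkowskiIntegrand_eq_zero hx hθ t]
    simp only [minkowskiIntegrand]
    have hterm : ∀ j < n, Integrable (fun p => ((n : ℝ) - j) * a j p - ((j : ℝ) + 1) * b (j + 1) p)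
        (areaMeasure x) := fun j hj =>
      ((hai j hj).const_mul _).sub ((hbi j hj).const_mul _)
    rw [integral_finsetSum _ fun j hj => (hterm j (Finset.mem_range.1 hj)).mul_const (t ^ j)]
    refine Finset.sum_congr rfl fun j hj => ?_
    have hj' := Finset.mem_range.1 hj
    rw [integral_mul_const, integral_sub ((hai j hj').const_mul _) ((hbi j hj').const_mul _),
      integral_const_mul, integral_const_mul]
  have hpoly : (∑ i ∈ Finset.range n, Polynomial.C (A i) * Polynomial.X ^ i : Polynomial ℝ) = 0 := by
    refine Polynomial.funext fun t => ?_
    simpa [Polynomial.eval_finsetSum] using hint t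
  have hcoeff := congrArg (fun P : Polynomial ℝ => P.coeff j) hpoly
  simp only [Polynomial.finsetSum_coeff, Polynomial.coeff_C_mul_X_pow, Polynomial.coeff_zero,
    Finset.sum_ite_eq, Finset.mem_range, if_pos hj] at hcoeff
  exact sub_eq_zero.1 hcoeff

end CapillaryHalfSpace

end

/-! ### The Minkowski formula for normalized mean curvatures. -/

theorem mainTheorem4 (n : ℕ) [NeZero n] {M : Type*} [TopologicalSpace M] [T2Space M]
    [CompactSpace M] [ChartedSpace (EuclideanHalfSpace n) M] [IsManifold (𝓡∂ n) ∞ M]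
    [MeasurableSpace M] [BorelSpace M]
    (θ : ℝ) (hθ : θ ∈ Set.Ioo 0 Real.pi)
    (x ν : M → EuclideanSpace ℝ (Fin (n + 1)))
    (hx : CapillaryHalfSpace.IsCapillaryImmersion θ x ν)
    (k : ℕ) (hk : 1 ≤ k) (hkn : k ≤ n) :
    Integrable (fun p => CapillaryHalfSpace.meanCurvature x ν (k - 1) p *
        (1 + Real.cos θ * inner ℝ (ν p) (CapillaryHalfSpace.e n)))
      (CapillaryHalfSpace.areaMeasure x) ∧
    Integrable (fun p => CapillaryHalfSpace.meanCurvature x ν k p * inner ℝ (x p) (ν p))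
      (CapillaryHalfSpace.areaMeasure x) ∧
    ∫ p, CapillaryHalfSpace.meanCurvature x ν (k - 1) p *
        (1 + Real.cos θ * inner ℝ (ν p) (CapillaryHalfSpace.e n))
        ∂(CapillaryHalfSpace.areaMeasure x) =
      ∫ p, CapillaryHalfSpace.meanCurvature x ν k p * inner ℝ (x p) (ν p)
        ∂(CapillaryHalfSpace.areaMeasure x) := by
  obtain ⟨j, rfl⟩ := Nat.exists_eq_add_of_le' hk
  have hj : j < n := hkn
  rw [Nat.add_sub_cancel]
  simp only [CapillaryHalfSpace.meanCurvature_eq, div_mul_eq_mul_div]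
  refine ⟨(CapillaryHalfSpace.integrable_sigma_mul_angle hx hθ hj.le).div_const _,
    (CapillaryHalfSpace.integrable_sigma_mul_support hx hθ hkn).div_const _, ?_⟩
  rw [integral_div, integral_div]
  have h1 := CapillaryHalfSpace.integral_sigma_identity hx hθ hj
  -- The factors `n - j` and `j + 1` of `integral_sigma_identity` are exactly absorbed by the ratio
  -- of the two binomial normalizations.
  have h2 : (n.choose (j + 1) : ℝ) * (j + 1) = n.choose j * (n - j) := by
    have := Nat.choose_succ_right_eq n j
    rw [← Nat.cast_sub hj.le]
    exact_mod_cast this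
  have h3 : (0 : ℝ) < n.choose j := by exact_mod_cast Nat.choose_pos hj.le
  have h4 : (0 : ℝ) < n.choose (j + 1) := by exact_mod_cast Nat.choose_pos hkn
  have h5 : (0 : ℝ) < (j : ℝ) + 1 := by positivity
  rw [div_eq_div_iff h3.ne' h4.ne']
  refine mul_right_cancel₀ h5.ne' ?_
  rw [mul_assoc, h2, mul_left_comm, mul_comm _ ((n : ℝ) - j), h1]
  ring
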